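/- Let $d\ge 1$ and let $X$ be a random vector in $\mathbb{R}^d$ (Euclidean norm $\|\cdot\|$), defined on a probability space $(\Omega,\mathcal F,\mathbb P)$, with $\mathbb{E}\|X\|^2<\infty$. A curve is a continuous map $f:[0,1]\to\mathbb{R}^d$; its length is $\mathscr L(f)=\sup\sum_{i=1}^n\|f(t_i)-f(t_{i-1})\|$ over all subdivisions $0=t_0\le\dots\le t_n=1$, and $\Delta(f)=\mathbb{E}[\min_{t\in[0,1]}\|X-f(t)\|^2]$. For $L\ge 0$ let $\mathcal C_L$ be either the set of all curves with $\mathscr L(f)\le L$ (open case), or the set of all curves with $\mathscr L(f)\le L$ and $f(0)=f(1)$ (closed case), and let $G(L)=\min_{f\in\mathcal C_L}\Delta(f)$. Let $L>0$ with $G(L)>0$, and let $f\in\mathcal C_L$ satisfy $\Delta(f)=G(L)$. Then $\mathscr L(f)=L$. If moreover $f$ is $L$-Lipschitz, then: 1. $f$ has a right derivative $f'_r(t)$ at every $t\in[0,1)$ and a left derivative $f'_\ell(t)$ at every $t\in(0,1]$, and $\|f'_r(t)\|=L$, resp. $\|f'_\ell(t)\|=L$, for all these $t$. 2. There is a finite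 $\mathbb{R}^d$-valued signed Borel measure $f''$ on $[0,1]$ such that $f''((s,t])=f'_r(t)-f'_r(s)$ for all $0\le s\le t<1$ and $f''([0,1])=0$, and which in the open case also satisfies $f''(\{0\})=f'_r(0)$ and $f''(\{1\})=-f'_\ell(1)$. In the open case $f''$ is the unique signed measure with these four properties. In the closed case, where the parameters $0$ and $1$ give the same point of the curve, $f''$ is unique as a measure on the circle obtained by gluing $0$ and $1$: any two signed measures with the first two properties agree on every Borel set $A\subset[0,1]$ that contains both of $0,1$ or neither; in that case we take for $f''$ the one with $f''(\{1\})=0$. 3. There is a unique $\lambda>0$ for which there exists, on some extension of the probability space, a random variable $\hat t$ with values in $[0,1]$ such that $\|X-f(\hat t)\|=\min_{t\in[0,1]}\|X-f(t)\|$ almost surely and, for every bounded Borel function $g:[0,1]\to\mathbb{R}^d$, $$\mathbb{E}\bigl[\langle X-f(\hat t),g(\hat t)\rangle\bigr]=-\lambda\int_{[0,1]}\langle g(t),f''(dt)\rangle,$$ where $\int\langle g,d\nu\rangle=\sum_{j=1}^d\int g^j\,d\nu^j$ for $\nu=(\nu^1,\dots,\nu^d)$. -/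

import Mathlib

open MeasureTheory Set
open scoped ENNReal unitInterval RealInnerProductSpace

universe u

noncomputable section

namespace PrincipalCurve

/-- The space `ℝ^d` with its Euclidean norm. -/
abbrev E (d : ℕ) : Type := EuclideanSpace ℝ (Fin d)

/-- The two settings: all curves, or only closed curves. -/
inductive CurveKind : Type
  | openCurves : CurveKind
  | closedCurves : CurveKind

/-- The length of a curve `[0,1] → ℝ^d`: the supremum of the lengths of inscribed polygons. -/
def length {d : ℕ} (f : C(I, E d)) : ℝ≥0∞ := eVariationOn f univ

/-- The class `C_L` of curves of length at most `L`; in the closed setting also `f 0 = f 1`. -/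
def curveClass (κ : CurveKind) (d : ℕ) (L : ℝ) : Set C(I, E d) :=
  {f | length f ≤ ENNReal.ofReal L ∧ (κ = CurveKind.closedCurves → f 0 = f 1)}

/-- The criterion `Δ(f) = 𝔼[min_t ‖X - f t‖²]`. -/
def criterion {Ω : Type*} [MeasurableSpace Ω] (P : Measure Ω) {d : ℕ} (X : Ω → E d)
    (f : C(I, E d)) : ℝ :=
  ∫ ω, ⨅ t : I, ‖X ω - f t‖ ^ 2 ∂P

/-- `G(L)`, the least value of the criterion over `C_L`. -/
def optimalValue {Ω : Type*} [MeasurableSpace Ω] (P : Measure Ω) {d : ℕ} (X : Ω → E d)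
    (κ : CurveKind) (L : ℝ) : ℝ :=
  sInf (criterion P X '' curveClass κ d L)

/-- A curve `[0,1] → ℝ^d` as a function on `ℝ`, constant on each side of `[0,1]`. Only its values
on `[0,1]` matter for right derivatives on `[0,1)` and left derivatives on `(0,1]`. -/
def extend {d : ℕ} (f : C(I, E d)) : ℝ → E d :=
  Set.IccExtend (zero_le_one : (0 : ℝ) ≤ 1) f

/-- `f` is right-differentiable at `t` (used for `t < 1`). -/
def RightDifferentiableAt {d : ℕ} (f : C(I, E d)) (t : I) : Prop :=
  DifferentiableWithinAt ℝ (extend f) (Ioi (t : ℝ)) t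

/-- `f` is left-differentiable at `t` (used for `0 < t`). -/
def LeftDifferentiableAt {d : ℕ} (f : C(I, E d)) (t : I) : Prop :=
  DifferentiableWithinAt ℝ (extend f) (Iio (t : ℝ)) t

/-- The right derivative `f'_r(t)` (used for `t < 1`). -/
def rightDeriv {d : ℕ} (f : C(I, E d)) (t : I) : E d :=
  derivWithin (extend f) (Ioi (t : ℝ)) t

/-- The left derivative `f'_ℓ(t)` (used for `0 < t`). -/
def leftDeriv {d : ℕ} (f : C(I, E d)) (t : I) : E d :=
  derivWithin (extend f) (Iio (t : ℝ)) t

/-- An `ℝ^d`-valued signed measure on `[0,1]`: a `d`-tuple of (finite) signed measures. -/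
abbrev VecSignedMeasure (d : ℕ) : Type := Fin d → SignedMeasure I

/-- The value `ν(A) ∈ ℝ^d`. -/
def VecSignedMeasure.value {d : ℕ} (ν : VecSignedMeasure d) (A : Set I) : E d :=
  WithLp.toLp 2 (fun j => ν j A)

/-- `∫ ⟨g(t), ν(dt)⟩ = ∑_j ∫ g^j(t) ν^j(dt)`. -/
def VecSignedMeasure.integral {d : ℕ} (ν : VecSignedMeasure d) (g : I → E d) : ℝ :=
  ∑ j, VectorMeasure.integral (ν j) (fun t => g t j) (ContinuousLinearMap.lsmul ℝ ℝ)

/-- The properties of the second derivative `f''` of the curve `f`. The conditions on the atoms at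
the endpoints are imposed in the open setting only. -/
structure IsSecondDerivative {d : ℕ} (κ : CurveKind) (f : C(I, E d)) (ν : VecSignedMeasure d) :
    Prop where
  increment : ∀ s t : I, s ≤ t → t < 1 →
    VecSignedMeasure.value ν (Ioc s t) = rightDeriv f t - rightDeriv f s
  total : VecSignedMeasure.value ν univ = 0
  atom_zero : κ = CurveKind.openCurves → VecSignedMeasure.value ν {0} = rightDeriv f 0
  atom_one : κ = CurveKind.openCurves → VecSignedMeasure.value ν {1} = - leftDeriv f 1

/-- Equality of measures on the parameter space of the curve: on `[0,1]` in the open setting, and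
on the circle obtained from `[0,1]` by gluing `0` and `1` in the closed setting (Borel sets of this
circle are Borel sets of `[0,1]` which contain both endpoints or neither). -/
def SameMeasure {d : ℕ} : CurveKind → VecSignedMeasure d → VecSignedMeasure d → Prop
  | CurveKind.openCurves, ν, ν' => ν = ν'
  | CurveKind.closedCurves, ν, ν' => ∀ A : Set I, MeasurableSet A → ((0 : I) ∈ A ↔ (1 : I) ∈ A) →
      VecSignedMeasure.value ν A = VecSignedMeasure.value ν' A

/-- On some extension `(Ω', P')` of the probability space `(Ω, P)`, with `proj : Ω' → Ω` the
measure preserving projection, there is a random variable `τ` with values in `[0,1]` such that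
`f(τ)` is almost surely a point of the curve closest to `X`, and
`𝔼⟨X - f(τ), g(τ)⟩ = -lam ∫ ⟨g, dν⟩` for all bounded Borel functions `g`. -/
def HasProjectionIndex {Ω : Type u} [MeasurableSpace Ω] (P : Measure Ω) {d : ℕ} (X : Ω → E d)
    (f : C(I, E d)) (ν : VecSignedMeasure d) (lam : ℝ) : Prop :=
  ∃ (Ω' : Type u) (_ : MeasurableSpace Ω') (P' : Measure Ω') (proj : Ω' → Ω) (τ : Ω' → I),
    IsProbabilityMeasure P' ∧ MeasurePreserving proj P' P ∧ Measurable τ ∧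
    (∀ᵐ ω ∂P', ‖X (proj ω) - f (τ ω)‖ = ⨅ t : I, ‖X (proj ω) - f t‖) ∧
    ∀ g : I → E d, Measurable g → (∃ C : ℝ, ∀ t, ‖g t‖ ≤ C) →
      ∫ ω, ⟪X (proj ω) - f (τ ω), g (τ ω)⟫ ∂P' = - lam * VecSignedMeasure.integral ν g

end PrincipalCurve

end

/-! Let `τ` select a nearest parameter measurably. The proof reads off the Euler–Lagrange equation
by perturbing `f` with kinks `t ↦ (min t s - θ s t) v`, where `θ = 1` for closed curves restores
equal endpoints. Keeping the old `τ` for the new curve bounds its criterion from above, so only a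
smooth quadratic in `ε` has to be differentiated. For an `L`-Lipschitz `f`, the length changes by at
most `(ε/L)⟪f s - f 0, v⟫ + O(ε²)` (`length_add_kinkCurve_le`). Two kinks at once give a multiplier
`λ ≥ 0` with `𝔼[kink s τ • (X - f τ)] = λ (f s - f 0)` for every `s` (`exists_multiplier`).

The left side is one-sidedly differentiable in `s` by dominated convergence. If `λ > 0`, then `f`
inherits one-sided derivatives, and `f'' = -λ⁻¹ 𝔼[(X - f τ); τ ∈ ·]`. Right continuity of `f'_r`
forces speed `L`: a slower stretch would make `f` shorter than `L`.

If the length is below `L`, or if `λ = 0`, the residual is orthogonal to every bounded function of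
`τ`. Contracting `f` by `1 - ε` then costs only `O(ε²)` and frees length for a spike of height `h`.
Its base point is not an atom of `τ`, so a thin spike harms almost nobody, while samples near it
gain at first order in `h`. Summing over `N` windows, with `h ~ N⁻²`, contradicts optimality
(`spike_bound_windows`).

For uniqueness of `λ`, all nearest choices have residual measures proportional to the same `f''`. A
mixture of two choices is again a nearest choice. If the mixture agrees with one of them on a set
charged by `f''`, the multipliers agree. Three disjoint charged sets suffice to pass from one choice
to the other in this way (`multiplier_unique`). Without three such sets the curve lies on a line,
where the nearest point is unique. -/

namespace PrincipalCurve

/-! ### Lengths of perturbed curves -/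

variable {d : ℕ}

/-- If the increments of `h` are dominated by those of a real function `H`, the length of `h` is at
most the total increment of `H`. -/
theorem eVariationOn_le_of_dominated (h : I → E d) (H : I → ℝ)
    (hH : ∀ s t : I, s ≤ t → ‖h t - h s‖ ≤ H t - H s) :
    eVariationOn h univ ≤ ENNReal.ofReal (H 1 - H 0) := by
  have hmono : Monotone H := fun s t hst => by
    have := (norm_nonneg _).trans (hH s t hst)
    linarith
  refine iSup_le ?_
  rintro ⟨n, u, hu, -⟩
  calc ∑ i ∈ Finset.range n, edist (h (u (i + 1))) (h (u i))
      ≤ ∑ i ∈ Finset.range n, ENNReal.ofReal (H (u (i + 1)) - H (u i)) := by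
        refine Finset.sum_le_sum fun i _ => ?_
        rw [edist_dist, dist_eq_norm]
        exact ENNReal.ofReal_le_ofReal (hH _ _ (hu (Nat.le_succ i)))
    _ = ENNReal.ofReal (∑ i ∈ Finset.range n, (H (u (i + 1)) - H (u i))) := by
        rw [ENNReal.ofReal_sum_of_nonneg]
        intro i _
        exact sub_nonneg.2 (hmono (hu (Nat.le_succ i)))
    _ ≤ ENNReal.ofReal (H 1 - H 0) := by
        rw [Finset.sum_range_sub (fun i => H (u i))]
        exact ENNReal.ofReal_le_ofReal
          (sub_le_sub (hmono unitInterval.le_one') (hmono unitInterval.nonneg'))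

/-- A relation which composes and which holds for all intervals not crossing `a` holds for all
intervals. -/
theorem rel_of_not_crossing {R : I → I → Prop} (hR : ∀ r s t, r ≤ s → s ≤ t → R r s → R s t → R r t)
    (a : I) {s t : I} (hst : s ≤ t)
    (h : ∀ s' t', s ≤ s' → s' ≤ t' → t' ≤ t → (t' ≤ a ∨ a ≤ s') → R s' t') : R s t := by
  rcases le_total t a with h1 | h1
  · exact h s t le_rfl hst le_rfl (Or.inl h1)
  rcases le_total a s with h2 | h2
  · exact h s t le_rfl hst le_rfl (Or.inr h2)
  exact hR s a t h2 h1 (h s a le_rfl h2 h1 (Or.inl le_rfl)) (h a t h2 h1 le_rfl (Or.inr le_rfl))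

theorem length_add_le (f g : C(I, E d)) : length (f + g) ≤ length f + length g := by
  refine iSup_le ?_
  rintro ⟨n, u, hu, hus⟩
  calc ∑ i ∈ Finset.range n, edist ((f + g) (u (i + 1))) ((f + g) (u i))
      ≤ ∑ i ∈ Finset.range n, (edist (f (u (i + 1))) (f (u i)) + edist (g (u (i + 1))) (g (u i))) :=
        Finset.sum_le_sum fun i _ => edist_add_add_le _ _ _ _
    _ ≤ _ := by
        rw [Finset.sum_add_distrib]
        exact add_le_add (eVariationOn.sum_le hu hus) (eVariationOn.sum_le hu hus)

theorem length_smul_le (c : ℝ) (f : C(I, E d)) :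
    length (c • f) ≤ ENNReal.ofReal |c| * length f := by
  refine iSup_le ?_
  rintro ⟨n, u, hu, hus⟩
  calc ∑ i ∈ Finset.range n, edist ((c • f) (u (i + 1))) ((c • f) (u i))
      = ENNReal.ofReal |c| * ∑ i ∈ Finset.range n, edist (f (u (i + 1))) (f (u i)) := by
        rw [Finset.mul_sum]
        refine Finset.sum_congr rfl fun i _ => ?_
        simp only [ContinuousMap.coe_smul, Pi.smul_apply]
        rw [edist_dist, edist_dist, ← ENNReal.ofReal_mul (abs_nonneg c), dist_smul₀, Real.norm_eq_abs]
    _ ≤ _ := by gcongr; exact eVariationOn.sum_le hu hus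

/-- `0` for open curves, `1` for closed curves. -/
noncomputable def closedWeight : CurveKind → ℝ
  | CurveKind.openCurves => 0
  | CurveKind.closedCurves => 1

theorem closedWeight_mem (κ : CurveKind) : 0 ≤ closedWeight κ ∧ closedWeight κ ≤ 1 := by
  cases κ <;> simp [closedWeight]

/-- The real function `t ↦ min t s - θ s t`, where `θ = 0` for open curves and `θ = 1` for closed
curves; in the latter case it vanishes at both endpoints. -/
noncomputable def kink (κ : CurveKind) (s t : ℝ) : ℝ := min t s - closedWeight κ * s * t

theorem continuous_kink (κ : CurveKind) (s : ℝ) : Continuous (kink κ s) := by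
  unfold kink; fun_prop

theorem abs_kink_le (κ : CurveKind) (s t : I) : |kink κ s t| ≤ 1 := by
  have hs := s.2
  have ht := t.2
  have h0 : 0 ≤ (s : ℝ) * t := mul_nonneg hs.1 ht.1
  have h1 : (s : ℝ) * t ≤ min (t : ℝ) s :=
    le_min (mul_le_of_le_one_left ht.1 hs.2) (mul_le_of_le_one_right hs.1 ht.2)
  have h2 : min (t : ℝ) s ≤ 1 := (min_le_left _ _).trans ht.2
  cases κ <;> simp only [kink, closedWeight, abs_le] <;> constructor <;> linarith

/-- The perturbation `t ↦ kink s t • v` as a curve. -/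
noncomputable def kinkCurve (κ : CurveKind) (s : I) (v : E d) : C(I, E d) where
  toFun t := kink κ s t • v
  continuous_toFun :=
    (((continuous_kink κ s).comp continuous_subtype_val).smul continuous_const)

@[simp] theorem kinkCurve_apply (κ : CurveKind) (s : I) (v : E d) (t : I) :
    kinkCurve κ s v t = kink κ s t • v := rfl

theorem length_kinkCurve_le (κ : CurveKind) (s : I) (v : E d) :
    length (kinkCurve κ s v) ≤ ENNReal.ofReal (2 * ‖v‖) := by
  refine (eVariationOn_le_of_dominated (d := d) _ (fun t => 2 * ‖v‖ * t) ?_).trans (by simp)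
  intro r t hrt
  have hs := s.2
  have hrt' : (r : ℝ) ≤ t := hrt
  have hκ := closedWeight_mem κ
  rw [kinkCurve_apply, kinkCurve_apply, ← sub_smul, norm_smul, ← mul_sub, mul_assoc,
    mul_comm ‖v‖, ← mul_assoc]
  gcongr
  have h1 : |min (t : ℝ) s - min (r : ℝ) s| ≤ t - r := by
    refine (abs_min_sub_min_le_max _ _ _ _).trans ?_
    rw [sub_self, abs_zero, abs_of_nonneg (by linarith)]
    exact max_le le_rfl (by linarith)
  have h2 : 0 ≤ closedWeight κ * s := mul_nonneg hκ.1 hs.1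
  have h3 : closedWeight κ * s ≤ 1 := mul_le_one₀ hκ.2 hs.1 hs.2
  rw [Real.norm_eq_abs, kink, kink, abs_le]
  rw [abs_le] at h1
  constructor <;> nlinarith

/-- On an interval not crossing `a`, the perturbation is affine. -/
theorem exists_slope_kink (κ : CurveKind) (f : I → E d) (a : I) (v : E d) {s t : I} (hst : s ≤ t)
    (h : t ≤ a ∨ a ≤ s) :
    ∃ w : E d, ‖w‖ ≤ ‖v‖ ∧ kinkCurve κ a v t - kinkCurve κ a v s = ((t : ℝ) - s) • w ∧
      ⟪f (min t a) - (closedWeight κ * a) • f t, v⟫ - ⟪f (min s a) - (closedWeight κ * a) • f s, v⟫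
        = ⟪f t - f s, w⟫ := by
  have hκ := closedWeight_mem κ
  have ha := a.2
  have hb0 : 0 ≤ closedWeight κ * a := mul_nonneg hκ.1 ha.1
  have hb1 : closedWeight κ * a ≤ 1 := mul_le_one₀ hκ.2 ha.1 ha.2
  rcases h with h | h
  · refine ⟨(1 - closedWeight κ * a) • v, ?_, ?_, ?_⟩
    · rw [norm_smul, Real.norm_eq_abs, abs_of_nonneg (by linarith)]
      exact mul_le_of_le_one_left (norm_nonneg v) (by linarith)
    · have h1 : min (t : ℝ) a = t := min_eq_left h
      have h2 : min (s : ℝ) a = s := min_eq_left (hst.trans h)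
      simp only [kinkCurve_apply, kink, h1, h2, ← sub_smul, smul_smul]
      congr 1; ring
    · rw [min_eq_left h, min_eq_left (hst.trans h)]
      simp only [inner_sub_left, inner_smul_left, inner_smul_right, RCLike.conj_to_real]
      ring
  · refine ⟨(- (closedWeight κ * a)) • v, ?_, ?_, ?_⟩
    · rw [norm_smul, Real.norm_eq_abs, abs_neg, abs_of_nonneg hb0]
      exact mul_le_of_le_one_left (norm_nonneg v) hb1
    · have h1 : min (t : ℝ) a = a := min_eq_right (h.trans hst)
      have h2 : min (s : ℝ) a = a := min_eq_right h
      simp only [kinkCurve_apply, kink, h1, h2, ← sub_smul, smul_smul]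
      congr 1; ring
    · rw [min_eq_right h, min_eq_right (h.trans hst)]
      simp only [inner_sub_left, inner_smul_left, inner_smul_right, RCLike.conj_to_real]
      ring

/-- A form of `√(1 + x) ≤ 1 + x/2`: squaring the right side reproduces the cross term and the
quadratic term, with a square to spare. The bound is linear in `u` and `δ`, so it telescopes over a
subdivision. -/
theorem norm_add_smul_le {V : Type*} [NormedAddCommGroup V] [InnerProductSpace ℝ V] {u w : V}
    {L δ ε K : ℝ} (hL : 0 < L) (hδ : 0 ≤ δ) (hε : 0 ≤ ε) (hu : ‖u‖ ≤ L * δ) (hw : ‖w‖ ≤ K) :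
    ‖u + ε • δ • w‖ ≤ L * δ + ε / L * ⟪u, w⟫ + ε ^ 2 * K ^ 2 / (2 * L) * δ := by
  have hK : 0 ≤ K := (norm_nonneg w).trans hw
  have hin : |⟪u, w⟫| ≤ L * δ * K :=
    (abs_real_inner_le_norm u w).trans (mul_le_mul hu hw (norm_nonneg w) (by positivity))
  have hinl := (abs_le.1 hin).1
  set p := ⟪u, w⟫
  set b := ε / L * p + ε ^ 2 * K ^ 2 / (2 * L) * δ with hb
  have hLb : L * b = ε * p + ε ^ 2 * K ^ 2 / 2 * δ := by
    rw [hb]; field_simp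
  -- Comparing squares needs a nonnegative right side; twice `L * (L * δ + b)` is at least `δ * ((L
  -- - ε * K) ^ 2 + L ^ 2)`.
  have hpos : 0 ≤ L * δ + b := by
    have h1 : 0 ≤ L * (L * δ + b) := by
      have h2 : -(ε * (L * δ * K)) ≤ ε * p := by
        rw [← mul_neg]; exact mul_le_mul_of_nonneg_left hinl hε
      have h3 : 0 ≤ δ * ((L - ε * K) ^ 2 + L ^ 2) := by positivity
      nlinarith
    exact nonneg_of_mul_nonneg_right h1 hL
  have hsq : ‖u + ε • δ • w‖ ^ 2 ≤ (L * δ + b) ^ 2 := by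
    rw [norm_add_sq_real, smul_smul, inner_smul_right, norm_smul, Real.norm_eq_abs, mul_pow, sq_abs]
    have h1 : ‖u‖ ^ 2 ≤ (L * δ) ^ 2 := pow_le_pow_left₀ (norm_nonneg u) hu 2
    have h2 : (ε * δ) ^ 2 * ‖w‖ ^ 2 ≤ (ε * δ) ^ 2 * K ^ 2 := by gcongr
    have h3 : 2 * (L * δ) * b = 2 * (ε * δ * p) + (ε * δ) ^ 2 * K ^ 2 := by
      linear_combination 2 * δ * hLb
    nlinarith [sq_nonneg b]
  rw [add_assoc]
  exact (abs_le_of_sq_le_sq' hsq hpos).2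

/-- First variation of the length of a Lipschitz curve in the direction of two kinks. -/
theorem length_add_kinkCurve_le (κ : CurveKind) {L : ℝ} (hL : 0 < L) (f : C(I, E d))
    (hf : LipschitzWith L.toNNReal f) (hκ : κ = CurveKind.closedCurves → f 0 = f 1)
    (a b : I) (v w : E d) {ε : ℝ} (hε : 0 ≤ ε) :
    length (f + ε • (kinkCurve κ a v + kinkCurve κ b w)) ≤
      ENNReal.ofReal (L + ε / L * (⟪f a - f 0, v⟫ + ⟪f b - f 0, w⟫) +
        ε ^ 2 * (‖v‖ + ‖w‖) ^ 2 / (2 * L)) := by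
  -- `A` plays the role of `∫ ⟪f', g'⟫` for the perturbation `g`, without assuming that `f` is
  -- differentiable. `H` then dominates the increments of the perturbed curve.
  set A : I → ℝ := fun t => ⟪f (min t a) - (closedWeight κ * a) • f t, v⟫ +
    ⟪f (min t b) - (closedWeight κ * b) • f t, w⟫ with hA
  set H : I → ℝ := fun t => L * t + ε / L * A t + ε ^ 2 * (‖v‖ + ‖w‖) ^ 2 / (2 * L) * t with hH
  have hLip : ∀ s t : I, s ≤ t → ‖f t - f s‖ ≤ L * ((t : ℝ) - s) := fun s t hst => by
    have := hf.dist_le_mul t s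
    rwa [dist_eq_norm, Real.coe_toNNReal _ hL.le, Subtype.dist_eq, Real.dist_eq,
      abs_of_nonneg (sub_nonneg.2 (Subtype.coe_le_coe.2 hst))] at this
  have key : ∀ s t : I, s ≤ t → (t ≤ a ∨ a ≤ s) → (t ≤ b ∨ b ≤ s) →
      ‖(f + ε • (kinkCurve κ a v + kinkCurve κ b w)) t -
        (f + ε • (kinkCurve κ a v + kinkCurve κ b w)) s‖ ≤ H t - H s := by
    intro s t hst h1 h2
    obtain ⟨v', hv1, hv2, hv3⟩ := exists_slope_kink κ f a v hst h1
    obtain ⟨w', hw1, hw2, hw3⟩ := exists_slope_kink κ f b w hst h2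
    have e1 : (f + ε • (kinkCurve κ a v + kinkCurve κ b w)) t -
        (f + ε • (kinkCurve κ a v + kinkCurve κ b w)) s =
        (f t - f s) + ε • ((t : ℝ) - s) • (v' + w') := by
      rw [smul_add ((t : ℝ) - s), ← hv2, ← hw2]
      simp only [ContinuousMap.add_apply, ContinuousMap.coe_smul, Pi.smul_apply, Pi.add_apply,
        ContinuousMap.coe_add, smul_add, smul_sub]
      abel
    rw [e1]
    refine (norm_add_smul_le hL (sub_nonneg.2 hst) hε (hLip s t hst)
      ((norm_add_le v' w').trans (add_le_add hv1 hw1))).trans (le_of_eq ?_)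
    have e2 : A t - A s = ⟪f t - f s, v' + w'⟫ := by
      rw [inner_add_right, ← hv3, ← hw3]; simp only [hA]; ring
    rw [← e2]; simp only [hH]; ring
  have htrans : ∀ r s t : I, r ≤ s → s ≤ t →
      ‖(f + ε • (kinkCurve κ a v + kinkCurve κ b w)) s -
        (f + ε • (kinkCurve κ a v + kinkCurve κ b w)) r‖ ≤ H s - H r →
      ‖(f + ε • (kinkCurve κ a v + kinkCurve κ b w)) t -
        (f + ε • (kinkCurve κ a v + kinkCurve κ b w)) s‖ ≤ H t - H s →
      ‖(f + ε • (kinkCurve κ a v + kinkCurve κ b w)) t -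
        (f + ε • (kinkCurve κ a v + kinkCurve κ b w)) r‖ ≤ H t - H r := by
    intro r s t _ _ h1 h2
    refine (norm_sub_le_norm_sub_add_norm_sub _
      ((f + ε • (kinkCurve κ a v + kinkCurve κ b w)) s) _).trans ?_
    linarith
  have hall : ∀ s t : I, s ≤ t → ‖(f + ε • (kinkCurve κ a v + kinkCurve κ b w)) t -
        (f + ε • (kinkCurve κ a v + kinkCurve κ b w)) s‖ ≤ H t - H s := by
    intro s t hst
    refine rel_of_not_crossing (R := fun s t => ‖(f + ε • (kinkCurve κ a v + kinkCurve κ b w)) t -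
        (f + ε • (kinkCurve κ a v + kinkCurve κ b w)) s‖ ≤ H t - H s) htrans a hst ?_
    intro s' t' _ hst' _ h1
    refine rel_of_not_crossing (R := fun s t => ‖(f + ε • (kinkCurve κ a v + kinkCurve κ b w)) t -
        (f + ε • (kinkCurve κ a v + kinkCurve κ b w)) s‖ ≤ H t - H s) htrans b hst' ?_
    intro s'' t'' g1 g2 g3 h2
    exact key s'' t'' g2 (h1.imp g3.trans fun h => h.trans g1) h2
  refine (eVariationOn_le_of_dominated _ H hall).trans (ENNReal.ofReal_le_ofReal (le_of_eq ?_))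
  -- The correction term of the kink drops out of the total increment: its weight is zero for open
  -- curves, and `f 0 = f 1` for closed ones.
  have hcl : closedWeight κ • (f 1 - f 0) = 0 := by
    cases κ
    · simp [closedWeight]
    · simp [hκ rfl]
  have hc : ∀ (x : ℝ) (z : E d), ⟪(closedWeight κ * x) • f 1, z⟫ - ⟪(closedWeight κ * x) • f 0, z⟫ =
      0 := by
    intro x z
    rw [← inner_sub_left, ← smul_sub, mul_comm, mul_smul, hcl, smul_zero, inner_zero_left]
  have e : A 1 - A 0 = ⟪f a - f 0, v⟫ + ⟪f b - f 0, w⟫ := by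
    have m1 : ∀ x : I, min 1 x = x := fun x => min_eq_right unitInterval.le_one'
    have m0 : ∀ x : I, min 0 x = 0 := fun x => min_eq_left unitInterval.nonneg'
    simp only [hA, m1, m0, inner_sub_left]
    linear_combination -(hc a v) - hc b w
  have : H 1 - H 0 = L + ε / L * (A 1 - A 0) + ε ^ 2 * (‖v‖ + ‖w‖) ^ 2 / (2 * L) := by
    simp only [hH, Set.Icc.coe_one, Set.Icc.coe_zero]; ring
  rw [this, e]

end PrincipalCurve

/-! ### First variation of the criterion and the Lagrange multiplier -/

namespace PrincipalCurve

/-- `τ` is a measurable choice of a parameter of a point of the curve closest to `X`. -/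
structure IsNearest {Ω : Type*} [MeasurableSpace Ω] (P : Measure Ω) {d : ℕ} (X : Ω → E d)
    (f : C(I, E d)) (τ : Ω → I) : Prop where
  measurable : Measurable τ
  nearest : ∀ᵐ ω ∂P, ‖X ω - f (τ ω)‖ = ⨅ t : I, ‖X ω - f t‖

/-- `f` minimizes the criterion over the class `C_L`. -/
structure IsOptimal {Ω : Type*} [MeasurableSpace Ω] (P : Measure Ω) {d : ℕ} (X : Ω → E d)
    (κ : CurveKind) (L : ℝ) (f : C(I, E d)) : Prop where
  mem : f ∈ curveClass κ d L
  le : ∀ h ∈ curveClass κ d L, criterion P X f ≤ criterion P X h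

variable {Ω : Type*} [MeasurableSpace Ω] {P : Measure Ω} [IsProbabilityMeasure P] {d : ℕ}
  {X : Ω → E d} {f : C(I, E d)} {τ : Ω → I} {κ : CurveKind} {L : ℝ}

theorem bddBelow_norm_sub (x : E d) (f : C(I, E d)) : BddBelow (range fun t : I => ‖x - f t‖) :=
  ⟨0, by rintro _ ⟨t, rfl⟩; exact norm_nonneg _⟩

theorem bddBelow_norm_sub_sq (x : E d) (f : C(I, E d)) :
    BddBelow (range fun t : I => ‖x - f t‖ ^ 2) :=
  ⟨0, by rintro _ ⟨t, rfl⟩; positivity⟩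

theorem memLp_comp (f : C(I, E d)) (hτ : Measurable τ) (p : ℝ≥0∞) :
    MemLp (fun ω => f (τ ω)) p P :=
  MemLp.of_bound (f.continuous.measurable.comp hτ).aestronglyMeasurable ‖f‖
    (Filter.Eventually.of_forall fun ω => f.norm_coe_le_norm (τ ω))

theorem memLp_residual (hX2 : MemLp X 2 P) (f : C(I, E d)) (hτ : Measurable τ) :
    MemLp (fun ω => X ω - f (τ ω)) 2 P :=
  hX2.sub (memLp_comp f hτ 2)

theorem integrable_residual (hX2 : MemLp X 2 P) (f : C(I, E d)) (hτ : Measurable τ) :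
    Integrable (fun ω => X ω - f (τ ω)) P :=
  (memLp_residual hX2 f hτ).integrable (by norm_num)

/-- Competitors can be tested with any convenient parameter choice, without knowing their own
nearest points. -/
theorem criterion_le (hX2 : MemLp X 2 P) (h : C(I, E d)) {ρ : Ω → I} (hρ : Measurable ρ) :
    criterion P X h ≤ ∫ ω, ‖X ω - h (ρ ω)‖ ^ 2 ∂P := by
  refine integral_mono_of_nonneg (Filter.Eventually.of_forall fun ω => ?_)
    ((memLp_residual hX2 h hρ).integrable_norm_pow (by norm_num))
    (Filter.Eventually.of_forall fun ω => ?_)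
  · exact Real.iInf_nonneg fun t => by positivity
  · exact ciInf_le (bddBelow_norm_sub_sq (X ω) h) (ρ ω)

omit [IsProbabilityMeasure P] in
theorem criterion_eq (hτ : IsNearest P X f τ) :
    criterion P X f = ∫ ω, ‖X ω - f (τ ω)‖ ^ 2 ∂P := by
  refine integral_congr_ae (hτ.nearest.mono fun ω h => ?_)
  refine le_antisymm (ciInf_le (bddBelow_norm_sub_sq (X ω) f) (τ ω)) (le_ciInf fun t => ?_)
  have : ‖X ω - f (τ ω)‖ ≤ ‖X ω - f t‖ := h ▸ ciInf_le (bddBelow_norm_sub (X ω) f) t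
  exact pow_le_pow_left₀ (norm_nonneg _) this 2

theorem integrable_inner_residual (hX2 : MemLp X 2 P) (hτ : Measurable τ) {g : I → E d}
    (hg : Measurable g) {C : ℝ} (hC : ∀ t, ‖g t‖ ≤ C) :
    Integrable (fun ω => ⟪X ω - f (τ ω), g (τ ω)⟫) P := by
  have h1 := integrable_residual hX2 f hτ
  refine Integrable.mono' (h1.norm.mul_const C)
    (h1.aestronglyMeasurable.inner (hg.comp hτ).aestronglyMeasurable)
    (Filter.Eventually.of_forall fun ω => ?_)
  exact (norm_inner_le_norm _ _).trans (mul_le_mul_of_nonneg_left (hC _) (norm_nonneg _))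

theorem integral_norm_sub_smul_sq (hX2 : MemLp X 2 P) (hτ : Measurable τ) (g : C(I, E d)) (ε : ℝ) :
    ∫ ω, ‖(X ω - f (τ ω)) - ε • g (τ ω)‖ ^ 2 ∂P =
      ∫ ω, ‖X ω - f (τ ω)‖ ^ 2 ∂P - 2 * ε * ∫ ω, ⟪X ω - f (τ ω), g (τ ω)⟫ ∂P +
        ε ^ 2 * ∫ ω, ‖g (τ ω)‖ ^ 2 ∂P := by
  have h1 := (memLp_residual hX2 f hτ).integrable_norm_pow (p := 2) (by norm_num)
  have h2 := integrable_inner_residual (f := f) hX2 hτ g.continuous.measurable g.norm_coe_le_norm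
  have h3 := (memLp_comp (P := P) g hτ 2).integrable_norm_pow (p := 2) (by norm_num)
  rw [← integral_const_mul, ← integral_const_mul, ← integral_sub h1 (h2.const_mul (2 * ε)),
    ← integral_add _ (h3.const_mul (ε ^ 2))]
  swap
  · exact h1.sub (h2.const_mul (2 * ε))
  refine integral_congr_ae (Filter.Eventually.of_forall fun ω => ?_)
  simp only [norm_sub_sq_real, inner_smul_right, norm_smul, mul_pow, Real.norm_eq_abs, sq_abs]
  ring

/-- If `f + ε g` is admissible for small `ε > 0`, the first variation of the criterion in the
direction `g` has a sign. -/
theorem integral_inner_nonpos (hX2 : MemLp X 2 P) (hτ : IsNearest P X f τ)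
    (hf : IsOptimal P X κ L f) (g : C(I, E d)) {ε₀ : ℝ} (hε₀ : 0 < ε₀)
    (hg : ∀ ε, 0 < ε → ε < ε₀ → f + ε • g ∈ curveClass κ d L) :
    ∫ ω, ⟪X ω - f (τ ω), g (τ ω)⟫ ∂P ≤ 0 := by
  set ψ := ∫ ω, ⟪X ω - f (τ ω), g (τ ω)⟫ ∂P with hψ
  set C := ∫ ω, ‖g (τ ω)‖ ^ 2 ∂P with hC
  have hC0 : 0 ≤ C := integral_nonneg fun ω => by positivity
  have key : ∀ ε, 0 < ε → ε < ε₀ → 2 * ψ ≤ ε * C := by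
    intro ε h0 h1
    have h2 := (hf.le _ (hg ε h0 h1)).trans (criterion_le hX2 _ hτ.measurable)
    rw [criterion_eq hτ] at h2
    have h3 : ∀ ω, X ω - (f + ε • g) (τ ω) = (X ω - f (τ ω)) - ε • g (τ ω) := fun ω => by
      simp [sub_sub]
    simp only [h3] at h2
    rw [integral_norm_sub_smul_sq hX2 hτ.measurable] at h2
    have h4 : ε * (2 * ψ) ≤ ε * (ε * C) := by
      rw [← hψ, ← hC] at h2; linarith
    exact le_of_mul_le_mul_left h4 h0
  by_contra! hpos
  -- Small enough that `ε * C ≤ ψ < 2 * ψ`; the `+ 1` covers `C = 0`.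
  set ε := min (ε₀ / 2) (ψ / (C + 1)) with hε
  have e0 : 0 < ε := lt_min (by linarith) (by positivity)
  have e1 := key ε e0 ((min_le_left _ _).trans_lt (by linarith))
  have e2 : ε * (C + 1) ≤ ψ := (le_div_iff₀ (by linarith)).1 (min_le_right _ _)
  nlinarith

/-- The moments of the residual against the kink functions. -/
noncomputable def kinkMoment (P : Measure Ω) (X : Ω → E d) (f : C(I, E d)) (κ : CurveKind)
    (τ : Ω → I) (s : ℝ) : E d := ∫ ω, kink κ s (τ ω) • (X ω - f (τ ω)) ∂P

theorem integrable_kink_smul (hX2 : MemLp X 2 P) (hτ : Measurable τ) (s : I) :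
    Integrable (fun ω => kink κ s (τ ω) • (X ω - f (τ ω))) P :=
  (integrable_residual hX2 f hτ).bdd_smul (1 : ℝ)
    (((continuous_kink κ s).comp continuous_subtype_val).measurable.comp hτ).aestronglyMeasurable
    (Filter.Eventually.of_forall fun ω => abs_kink_le κ s (τ ω))

theorem integral_inner_kinkCurve (hX2 : MemLp X 2 P) (hτ : Measurable τ) (s : I) (v : E d) :
    ∫ ω, ⟪X ω - f (τ ω), kinkCurve κ s v (τ ω)⟫ ∂P = ⟪kinkMoment P X f κ τ s, v⟫ := by
  rw [kinkMoment, real_inner_comm, ← integral_inner (integrable_kink_smul hX2 hτ s)]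
  refine integral_congr_ae (Filter.Eventually.of_forall fun ω => ?_)
  simp only [kinkCurve_apply, inner_smul_right, real_inner_comm]

theorem integral_inner_two_kinks (hX2 : MemLp X 2 P) (hτ : Measurable τ) (a b : I) (v w : E d) :
    ∫ ω, ⟪X ω - f (τ ω), (kinkCurve κ a v + kinkCurve κ b w) (τ ω)⟫ ∂P =
      ⟪kinkMoment P X f κ τ a, v⟫ + ⟪kinkMoment P X f κ τ b, w⟫ := by
  rw [← integral_inner_kinkCurve hX2 hτ, ← integral_inner_kinkCurve hX2 hτ, ← integral_add
    (integrable_inner_residual hX2 hτ (ContinuousMap.continuous _).measurable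
      (ContinuousMap.norm_coe_le_norm _))
    (integrable_inner_residual hX2 hτ (ContinuousMap.continuous _).measurable
      (ContinuousMap.norm_coe_le_norm _))]
  simp only [ContinuousMap.add_apply, inner_add_right]

theorem kinkCurve_endpoints (a : I) (v : E d) :
    kinkCurve CurveKind.closedCurves a v 0 = kinkCurve CurveKind.closedCurves a v 1 := by
  have ha := a.2
  simp [kink, closedWeight, min_eq_left ha.1, min_eq_right ha.2]

/-- Translations preserve both length and closedness, so they are admissible in every direction. -/
theorem integral_residual_eq_zero (hX2 : MemLp X 2 P) (hτ : IsNearest P X f τ)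
    (hf : IsOptimal P X κ L f) : ∫ ω, (X ω - f (τ ω)) ∂P = 0 := by
  have h1 : ∀ v : E d, ⟪∫ ω, (X ω - f (τ ω)) ∂P, v⟫ ≤ 0 := by
    intro v
    have := integral_inner_nonpos hX2 hτ hf (ContinuousMap.const I v) one_pos ?_
    · rwa [real_inner_comm, ← integral_inner (integrable_residual hX2 f hτ.measurable),
        integral_congr_ae (Filter.Eventually.of_forall fun ω => real_inner_comm _ _)]
    · intro ε _ _
      refine ⟨?_, fun h => ?_⟩
      · refine (length_add_le _ _).trans ?_
        have : length (ε • ContinuousMap.const I v) = 0 :=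
          eVariationOn.constant_on (by rintro _ ⟨_, _, rfl⟩ _ ⟨_, _, rfl⟩; rfl)
        rw [this, add_zero]
        exact hf.mem.1
      · simp [hf.mem.2 h]
  have := h1 (∫ ω, (X ω - f (τ ω)) ∂P)
  rwa [real_inner_self_nonpos] at this

/-- With spare length every small kink is admissible, so the constraint exerts no force. The crude
bound `2‖v‖` on the length of a kink is enough, and `f` need not be Lipschitz. -/
theorem kinkMoment_eq_zero_of_length_lt (hX2 : MemLp X 2 P) (hτ : IsNearest P X f τ)
    (hf : IsOptimal P X κ L f) (hlen : length f < ENNReal.ofReal L) (s : I) :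
    kinkMoment P X f κ τ s = 0 := by
  have h1 : ∀ v : E d, ⟪kinkMoment P X f κ τ s, v⟫ ≤ 0 := by
    intro v
    obtain ⟨ℓ, hℓ0, hℓ⟩ : ∃ ℓ, 0 ≤ ℓ ∧ length f = ENNReal.ofReal ℓ :=
      ⟨(length f).toReal, ENNReal.toReal_nonneg, (ENNReal.ofReal_toReal hlen.ne_top).symm⟩
    have hℓL : ℓ < L := by
      rw [hℓ] at hlen
      exact (ENNReal.ofReal_lt_ofReal_iff_of_nonneg hℓ0).1 hlen
    rw [← integral_inner_kinkCurve hX2 hτ.measurable]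
    refine integral_inner_nonpos hX2 hτ hf _ (ε₀ := (L - ℓ) / (2 * ‖v‖ + 1))
      (div_pos (by linarith) (by positivity)) fun ε h0 h1 => ⟨?_, fun h => ?_⟩
    · rw [lt_div_iff₀ (by positivity)] at h1
      refine (length_add_le _ _).trans ((add_le_add hℓ.le ((length_smul_le _ _).trans
        (mul_le_mul_right (length_kinkCurve_le κ s v) _))).trans ?_)
      rw [← ENNReal.ofReal_mul (abs_nonneg _), ← ENNReal.ofReal_add hℓ0 (by positivity),
        abs_of_pos h0]
      exact ENNReal.ofReal_le_ofReal (by nlinarith)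
    · subst h
      rw [ContinuousMap.add_apply, ContinuousMap.add_apply, hf.mem.2 rfl]
      simp only [ContinuousMap.coe_smul, Pi.smul_apply, kinkCurve_endpoints]
  have := h1 (kinkMoment P X f κ τ s)
  rwa [real_inner_self_nonpos] at this

/-- Existence of the Lagrange multiplier. -/
theorem exists_multiplier (hX2 : MemLp X 2 P) (hτ : IsNearest P X f τ)
    (hf : IsOptimal P X κ L f) (hL : 0 < L) (hlip : LipschitzWith L.toNNReal f)
    (hlen : length f = ENNReal.ofReal L) :
    ∃ lam : ℝ, 0 ≤ lam ∧ ∀ s : I, kinkMoment P X f κ τ s = lam • (f s - f 0) := by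
  obtain ⟨a, ha⟩ : ∃ a, f a - f 0 ≠ 0 := by
    by_contra! hcon
    have : length f = 0 := eVariationOn.constant_on (by
      rintro _ ⟨s, _, rfl⟩ _ ⟨t, _, rfl⟩
      rw [sub_eq_zero.1 (hcon s), sub_eq_zero.1 (hcon t)])
    rw [hlen, ENNReal.ofReal_eq_zero] at this
    linarith
  -- A strictly negative first variation of length absorbs the `ε²` term for small `ε`, so the
  -- perturbed curve stays admissible.
  have key : ∀ (s : I) (v w : E d), ⟪f s - f 0, v⟫ + ⟪f a - f 0, w⟫ < 0 →
      ⟪kinkMoment P X f κ τ s, v⟫ + ⟪kinkMoment P X f κ τ a, w⟫ ≤ 0 := by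
    intro s v w hneg
    set p := ⟪f s - f 0, v⟫ + ⟪f a - f 0, w⟫ with hp
    set C := (‖v‖ + ‖w‖) ^ 2 with hC
    have hC0 : 0 ≤ C := by positivity
    rw [← integral_inner_two_kinks hX2 hτ.measurable]
    refine integral_inner_nonpos hX2 hτ hf _ (ε₀ := -p / (C + 1))
      (div_pos (by linarith) (by positivity)) fun ε h0 h1 => ⟨?_, fun h => ?_⟩
    · rw [lt_div_iff₀ (by positivity)] at h1
      refine (length_add_kinkCurve_le κ hL f hlip hf.mem.2 s a v w h0.le).trans
        (ENNReal.ofReal_le_ofReal ?_)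
      rw [← hp, ← hC]
      have : ε / L * p + ε ^ 2 * C / (2 * L) = ε / L * (p + ε * C / 2) := by field_simp
      have h2 : p + ε * C / 2 ≤ 0 := by nlinarith
      have h3 := mul_nonpos_of_nonneg_of_nonpos (div_pos h0 hL).le h2
      linarith
    · subst h
      rw [ContinuousMap.add_apply, ContinuousMap.add_apply, hf.mem.2 rfl]
      simp only [ContinuousMap.coe_smul, Pi.smul_apply, ContinuousMap.add_apply, kinkCurve_endpoints]
  set q := f a - f 0 with hq
  have hq2 : 0 < ‖q‖ ^ 2 := by positivity
  set lam := ⟪kinkMoment P X f κ τ a, q⟫ / ‖q‖ ^ 2 with hlam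
  -- The kink at `a` along `-q` compensates the length change of the kink at `s`, leaving a total
  -- first variation `-η < 0`; then `η` is made arbitrarily small.
  have hle : ∀ (s : I) (v : E d),
      ⟪kinkMoment P X f κ τ s, v⟫ ≤ lam * ⟪f s - f 0, v⟫ := by
    intro s v
    refine le_of_forall_pos_le_add fun δ hδ => ?_
    set η := δ / (|lam| + 1) with hη
    have hη0 : 0 < η := by positivity
    have h1 := key s v (-((⟪f s - f 0, v⟫ + η) / ‖q‖ ^ 2) • q) (by
      rw [inner_smul_right, real_inner_self_eq_norm_sq, neg_mul, div_mul_cancel₀ _ hq2.ne']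
      linarith)
    rw [inner_smul_right] at h1
    have h2 : -((⟪f s - f 0, v⟫ + η) / ‖q‖ ^ 2) * ⟪kinkMoment P X f κ τ a, q⟫ =
        -(lam * ⟪f s - f 0, v⟫) - lam * η := by rw [hlam]; field_simp; ring
    have h3 : lam * η ≤ δ := by
      have : (|lam| + 1) * η = δ := by rw [hη]; field_simp
      nlinarith [le_abs_self lam]
    linarith
  refine ⟨lam, ?_, fun s => ?_⟩
  · have h1 := key a 0 (-q) (by
      rw [inner_zero_right, inner_neg_right, real_inner_self_eq_norm_sq]; linarith)
    rw [inner_zero_right, inner_neg_right] at h1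
    exact div_nonneg (by linarith) hq2.le
  · refine ext_inner_right ℝ fun v => ?_
    rw [real_inner_smul_left]
    refine le_antisymm (hle s v) ?_
    have := hle s (-v)
    rw [inner_neg_right, inner_neg_right] at this
    linarith

end PrincipalCurve

/-! ### Differentiating the kink moments; the residual measure -/

namespace PrincipalCurve

section Truncation

open Filter Topology

variable {Ω : Type*} [MeasurableSpace Ω] {P : Measure Ω} {V : Type*} [NormedAddCommGroup V]
  [NormedSpace ℝ V] {Y : Ω → V} {T : Ω → ℝ}

theorem integrable_min_smul (hY : Integrable Y P) (hT : Measurable T)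
    (hT1 : ∀ ω, T ω ∈ Icc (0 : ℝ) 1) (s : ℝ) :
    Integrable (fun ω => min (T ω) s • Y ω) P := by
  refine hY.bdd_smul (1 + |s|) (hT.min measurable_const).aestronglyMeasurable
    (Eventually.of_forall fun ω => ?_)
  have h := hT1 ω
  rw [Real.norm_eq_abs, abs_le]
  have h1 := neg_abs_le s
  have h2 := abs_nonneg s
  exact ⟨le_min (by linarith [h.1]) (by linarith), (min_le_left _ _).trans (by linarith [h.2])⟩

theorem slope_integral_min (hY : Integrable Y P) (hT : Measurable T)
    (hT1 : ∀ ω, T ω ∈ Icc (0 : ℝ) 1) (s t : ℝ) :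
    slope (fun s => ∫ ω, min (T ω) s • Y ω ∂P) t s =
      ∫ ω, ((s - t)⁻¹ * (min (T ω) s - min (T ω) t)) • Y ω ∂P := by
  rw [slope_def_module, ← integral_sub (integrable_min_smul hY hT hT1 s)
    (integrable_min_smul hY hT hT1 t), ← integral_smul]
  simp only [mul_smul, sub_smul]

omit [MeasurableSpace Ω] in
theorem norm_slope_min_smul_le (s t : ℝ) (ω : Ω) :
    ‖((s - t)⁻¹ * (min (T ω) s - min (T ω) t)) • Y ω‖ ≤ ‖Y ω‖ := by
  rw [norm_smul]
  refine mul_le_of_le_one_left (norm_nonneg _) ?_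
  have h1 : |min (T ω) s - min (T ω) t| ≤ |s - t| := by
    refine (abs_min_sub_min_le_max _ _ _ _).trans ?_
    simp
  rw [norm_mul, norm_inv, Real.norm_eq_abs, Real.norm_eq_abs]
  exact inv_mul_le_one_of_le₀ h1 (abs_nonneg _)

/-- The difference quotients of `min (T ω)` are bounded by `1` and converge to the indicator of `t <
T ω` from the right, of `t ≤ T ω` from the left. The two derivatives differ by the mass at `T = t`,
which is how atoms of `f''` arise. -/
theorem hasDerivWithinAt_integral_min_right (hY : Integrable Y P) (hT : Measurable T)
    (hT1 : ∀ ω, T ω ∈ Icc (0 : ℝ) 1) (t : ℝ) :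
    HasDerivWithinAt (fun s => ∫ ω, min (T ω) s • Y ω ∂P) (∫ ω in {ω | t < T ω}, Y ω ∂P)
      (Ioi t) t := by
  rw [hasDerivWithinAt_iff_tendsto_slope' self_notMem_Ioi,
    ← integral_indicator (measurableSet_lt measurable_const hT)]
  refine (tendsto_congr (slope_integral_min hY hT hT1 · t)).2 ?_
  refine tendsto_integral_filter_of_dominated_convergence (fun ω => ‖Y ω‖)
    (Eventually.of_forall fun s => ((hT.min measurable_const).sub
      (hT.min measurable_const)).const_mul _ |>.aestronglyMeasurable.smul hY.aestronglyMeasurable)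
    (Eventually.of_forall fun s => Eventually.of_forall fun ω => norm_slope_min_smul_le s t ω)
    hY.norm (Eventually.of_forall fun ω => ?_)
  refine tendsto_const_nhds.congr' ?_
  by_cases h : t < T ω
  · filter_upwards [Ioo_mem_nhdsGT h] with s hs
    have h1 : s - t ≠ 0 := (sub_pos.2 hs.1).ne'
    rw [min_eq_right hs.2.le, min_eq_right h.le, inv_mul_cancel₀ h1, one_smul,
      indicator_of_mem (show ω ∈ {ω | t < T ω} from h)]
  · filter_upwards [self_mem_nhdsWithin] with s hs
    have hs' : t < s := hs
    rw [min_eq_left ((not_lt.1 h).trans hs'.le), min_eq_left (not_lt.1 h), sub_self, mul_zero,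
      zero_smul, indicator_of_notMem (show ω ∉ {ω | t < T ω} from h)]

theorem hasDerivWithinAt_integral_min_left (hY : Integrable Y P) (hT : Measurable T)
    (hT1 : ∀ ω, T ω ∈ Icc (0 : ℝ) 1) (t : ℝ) :
    HasDerivWithinAt (fun s => ∫ ω, min (T ω) s • Y ω ∂P) (∫ ω in {ω | t ≤ T ω}, Y ω ∂P)
      (Iio t) t := by
  rw [hasDerivWithinAt_iff_tendsto_slope' self_notMem_Iio,
    ← integral_indicator (measurableSet_le measurable_const hT)]
  refine (tendsto_congr (slope_integral_min hY hT hT1 · t)).2 ?_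
  refine tendsto_integral_filter_of_dominated_convergence (fun ω => ‖Y ω‖)
    (Eventually.of_forall fun s => ((hT.min measurable_const).sub
      (hT.min measurable_const)).const_mul _ |>.aestronglyMeasurable.smul hY.aestronglyMeasurable)
    (Eventually.of_forall fun s => Eventually.of_forall fun ω => norm_slope_min_smul_le s t ω)
    hY.norm (Eventually.of_forall fun ω => ?_)
  refine tendsto_const_nhds.congr' ?_
  by_cases h : t ≤ T ω
  · filter_upwards [self_mem_nhdsWithin] with s hs
    have hs' : s < t := hs
    have h1 : s - t ≠ 0 := (sub_neg.2 hs').ne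
    rw [min_eq_right (hs'.le.trans h), min_eq_right h, inv_mul_cancel₀ h1, one_smul,
      indicator_of_mem (show ω ∈ {ω | t ≤ T ω} from h)]
  · filter_upwards [Ioo_mem_nhdsLT (not_le.1 h)] with s hs
    rw [min_eq_left hs.1.le, min_eq_left (not_le.1 h).le, sub_self, mul_zero,
      zero_smul, indicator_of_notMem (show ω ∉ {ω | t ≤ T ω} from h)]

/-- This yields right continuity of the right derivative of `f`; the companion limit from the left
identifies the left derivative as a left limit of right derivatives. -/
theorem tendsto_setIntegral_lt_right (hY : Integrable Y P) (hT : Measurable T) (t : ℝ) :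
    Tendsto (fun s => ∫ ω in {ω | s < T ω}, Y ω ∂P) (𝓝[>] t)
      (𝓝 (∫ ω in {ω | t < T ω}, Y ω ∂P)) := by
  simp only [← integral_indicator (measurableSet_lt measurable_const hT)]
  refine tendsto_integral_filter_of_dominated_convergence (fun ω => ‖Y ω‖)
    (Eventually.of_forall fun s =>
      hY.aestronglyMeasurable.indicator (measurableSet_lt measurable_const hT))
    (Eventually.of_forall fun s => Eventually.of_forall fun ω => norm_indicator_le_norm_self _ _)
    hY.norm (Eventually.of_forall fun ω => ?_)
  refine tendsto_const_nhds.congr' ?_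
  by_cases h : t < T ω
  · filter_upwards [Ioo_mem_nhdsGT h] with s hs
    rw [indicator_of_mem (show ω ∈ {ω | s < T ω} from hs.2),
      indicator_of_mem (show ω ∈ {ω | t < T ω} from h)]
  · filter_upwards [self_mem_nhdsWithin] with s hs
    have hs' : ¬ s < T ω := fun h' => h (lt_trans hs h')
    rw [indicator_of_notMem (show ω ∉ {ω | s < T ω} from hs'),
      indicator_of_notMem (show ω ∉ {ω | t < T ω} from h)]

theorem tendsto_setIntegral_lt_left (hY : Integrable Y P) (hT : Measurable T) (t : ℝ) :
    Tendsto (fun s => ∫ ω in {ω | s < T ω}, Y ω ∂P) (𝓝[<] t)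
      (𝓝 (∫ ω in {ω | t ≤ T ω}, Y ω ∂P)) := by
  simp only [← integral_indicator (measurableSet_lt measurable_const hT),
    ← integral_indicator (measurableSet_le measurable_const hT)]
  refine tendsto_integral_filter_of_dominated_convergence (fun ω => ‖Y ω‖)
    (Eventually.of_forall fun s =>
      hY.aestronglyMeasurable.indicator (measurableSet_lt measurable_const hT))
    (Eventually.of_forall fun s => Eventually.of_forall fun ω => norm_indicator_le_norm_self _ _)
    hY.norm (Eventually.of_forall fun ω => ?_)
  refine tendsto_const_nhds.congr' ?_
  by_cases h : t ≤ T ω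
  · filter_upwards [self_mem_nhdsWithin] with s hs
    have hs' : s < T ω := lt_of_lt_of_le hs h
    rw [indicator_of_mem (show ω ∈ {ω | s < T ω} from hs'),
      indicator_of_mem (show ω ∈ {ω | t ≤ T ω} from h)]
  · filter_upwards [Ioo_mem_nhdsLT (not_le.1 h)] with s hs
    rw [indicator_of_notMem (show ω ∉ {ω | s < T ω} from not_lt.2 hs.1.le),
      indicator_of_notMem (show ω ∉ {ω | t ≤ T ω} from h)]

end Truncation

variable {Ω : Type*} [MeasurableSpace Ω] {P : Measure Ω} [IsProbabilityMeasure P] {d : ℕ}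
  {X : Ω → E d} {f : C(I, E d)} {τ : Ω → I} {κ : CurveKind} {L : ℝ}

/-- The vector measure `A ↦ 𝔼[(X - f(τ)) 1_{τ ∈ A}]`. -/
noncomputable def residualMass (P : Measure Ω) (X : Ω → E d) (f : C(I, E d)) (τ : Ω → I)
    (A : Set I) : E d := ∫ ω in τ ⁻¹' A, (X ω - f (τ ω)) ∂P

/-- The first moment of the residual, with weight `0` for open curves. -/
noncomputable def momentDrift (P : Measure Ω) (X : Ω → E d) (f : C(I, E d)) (κ : CurveKind)
    (τ : Ω → I) : E d := closedWeight κ • ∫ ω, (τ ω : ℝ) • (X ω - f (τ ω)) ∂P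

theorem kinkMoment_eq (hX2 : MemLp X 2 P) (hτ : Measurable τ) (s : ℝ) :
    kinkMoment P X f κ τ s =
      (∫ ω, min (τ ω : ℝ) s • (X ω - f (τ ω)) ∂P) - s • momentDrift P X f κ τ := by
  have hY := integrable_residual hX2 f hτ
  have hT : Measurable fun ω => (τ ω : ℝ) := measurable_subtype_coe.comp hτ
  have h1 := integrable_min_smul hY hT (fun ω => (τ ω).2) s
  have h2 := integrable_min_smul hY hT (fun ω => (τ ω).2) 1
  simp only [fun ω => min_eq_left (τ ω).2.2] at h2
  rw [kinkMoment, momentDrift, smul_smul, ← integral_smul, ← integral_sub h1]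
  swap
  · exact h2.smul (s * closedWeight κ)
  refine integral_congr_ae (Filter.Eventually.of_forall fun ω => ?_)
  simp only [kink, sub_smul, smul_smul, mul_comm s]

theorem hasDerivWithinAt_kinkMoment_right (hX2 : MemLp X 2 P) (hτ : Measurable τ) (t : I) :
    HasDerivWithinAt (kinkMoment P X f κ τ)
      (residualMass P X f τ (Ioi t) - momentDrift P X f κ τ) (Ioi (t : ℝ)) t := by
  have hT : Measurable fun ω => (τ ω : ℝ) := measurable_subtype_coe.comp hτ
  have h := (hasDerivWithinAt_integral_min_right (integrable_residual hX2 f hτ) hT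
    (fun ω => (τ ω).2) t).sub ((hasDerivWithinAt_id (t : ℝ) (Ioi (t : ℝ))).smul_const
      (momentDrift P X f κ τ))
  rw [one_smul] at h
  exact h.congr (fun s _ => kinkMoment_eq hX2 hτ s) (kinkMoment_eq hX2 hτ t)

theorem hasDerivWithinAt_kinkMoment_left (hX2 : MemLp X 2 P) (hτ : Measurable τ) (t : I) :
    HasDerivWithinAt (kinkMoment P X f κ τ)
      (residualMass P X f τ (Ici t) - momentDrift P X f κ τ) (Iio (t : ℝ)) t := by
  have hT : Measurable fun ω => (τ ω : ℝ) := measurable_subtype_coe.comp hτ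
  have h := (hasDerivWithinAt_integral_min_left (integrable_residual hX2 f hτ) hT
    (fun ω => (τ ω).2) t).sub ((hasDerivWithinAt_id (t : ℝ) (Iio (t : ℝ))).smul_const
      (momentDrift P X f κ τ))
  rw [one_smul] at h
  exact h.congr (fun s _ => kinkMoment_eq hX2 hτ s) (kinkMoment_eq hX2 hτ t)

theorem tendsto_residualMass_right (hX2 : MemLp X 2 P) (hτ : Measurable τ) (t : I) :
    Filter.Tendsto (fun s : I => residualMass P X f τ (Ioi s)) (nhdsWithin t (Ioi t))
      (nhds (residualMass P X f τ (Ioi t))) :=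
  (tendsto_setIntegral_lt_right (integrable_residual hX2 f hτ)
    (measurable_subtype_coe.comp hτ) (t : ℝ)).comp
    (continuous_subtype_val.continuousWithinAt.tendsto_nhdsWithin fun _ h => h)

theorem tendsto_residualMass_left (hX2 : MemLp X 2 P) (hτ : Measurable τ) (t : I) :
    Filter.Tendsto (fun s : I => residualMass P X f τ (Ioi s)) (nhdsWithin t (Iio t))
      (nhds (residualMass P X f τ (Ici t))) :=
  (tendsto_setIntegral_lt_left (integrable_residual hX2 f hτ)
    (measurable_subtype_coe.comp hτ) (t : ℝ)).comp
    (continuous_subtype_val.continuousWithinAt.tendsto_nhdsWithin fun _ h => h)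

theorem residualMass_union (hX2 : MemLp X 2 P) (hτ : Measurable τ) {A B : Set I}
    (hAB : Disjoint A B) (hB : MeasurableSet B) :
    residualMass P X f τ (A ∪ B) = residualMass P X f τ A + residualMass P X f τ B := by
  have hY := integrable_residual hX2 f hτ
  rw [residualMass, preimage_union]
  exact setIntegral_union (hAB.preimage τ) (hτ hB) hY.integrableOn hY.integrableOn

omit [IsProbabilityMeasure P] in
theorem residualMass_univ : residualMass P X f τ univ = ∫ ω, (X ω - f (τ ω)) ∂P := by
  simp [residualMass]

/-- The coordinates of `A ↦ 𝔼[(X - f(τ)) 1_{τ ∈ A}]`, scaled by `c`, as signed measures. -/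
noncomputable def residualMeasure (P : Measure Ω) (X : Ω → E d) (f : C(I, E d)) (τ : Ω → I) (c : ℝ) :
    VecSignedMeasure d :=
  fun j => c • (P.withDensityᵥ fun ω => (X ω - f (τ ω)) j).map τ

theorem integrable_residual_apply (hX2 : MemLp X 2 P) (hτ : Measurable τ) (j : Fin d) :
    Integrable (fun ω => (X ω - f (τ ω)) j) P :=
  (EuclideanSpace.proj (𝕜 := ℝ) j).integrable_comp (integrable_residual hX2 f hτ)

theorem value_residualMeasure (hX2 : MemLp X 2 P) (hτ : Measurable τ) (c : ℝ) {A : Set I}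
    (hA : MeasurableSet A) :
    (residualMeasure P X f τ c).value A = c • residualMass P X f τ A := by
  ext j
  have h := (EuclideanSpace.proj (𝕜 := ℝ) j).integral_comp_comm
    (integrable_residual (P := P) hX2 f hτ).integrableOn (μ := P.restrict (τ ⁻¹' A))
  simp only [PiLp.proj_apply] at h
  simp only [VecSignedMeasure.value, residualMeasure, PiLp.smul_apply, residualMass]
  rw [_root_.smul_apply, VectorMeasure.map_apply _ hτ hA,
    withDensityᵥ_apply (integrable_residual_apply hX2 hτ j) (hτ hA), h]

omit [IsProbabilityMeasure P] in
-- Splitting the density into positive and negative parts reduces the integral to two ordinary ones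
-- against finite measures.
theorem integral_withDensityᵥ {u g : Ω → ℝ} (hu : Integrable u P) (hg : Measurable g) {C : ℝ}
    (hC : ∀ ω, |g ω| ≤ C) :
    VectorMeasure.integral (P.withDensityᵥ u) g (ContinuousLinearMap.lsmul ℝ ℝ) =
      ∫ ω, u ω * g ω ∂P := by
  have hflip : (ContinuousLinearMap.lsmul ℝ ℝ : ℝ →L[ℝ] ℝ →L[ℝ] ℝ) =
      (ContinuousLinearMap.lsmul ℝ ℝ).flip := by
    ext; simp
  have hfin₁ := isFiniteMeasure_withDensity_ofReal hu.2
  have hfin₂ := isFiniteMeasure_withDensity_ofReal hu.neg.2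
  have hint : ∀ (Q : Measure Ω) [IsFiniteMeasure Q], Q.toSignedMeasure.Integrable g := by
    intro Q _
    rw [VectorMeasure.Integrable, Measure.variation_toSignedMeasure]
    exact Integrable.of_bound hg.aestronglyMeasurable C (Filter.Eventually.of_forall hC)
  have hdens : ∀ w : Ω → ℝ, Integrable w P →
      ∫ ω, g ω ∂(P.withDensity fun ω => ENNReal.ofReal (w ω)) = ∫ ω, max (w ω) 0 * g ω ∂P := by
    intro w hw
    rw [integral_withDensity_eq_integral_toReal_smul₀ hw.aemeasurable.ennreal_ofReal
      (Filter.Eventually.of_forall fun _ => ENNReal.ofReal_lt_top)]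
    simp only [ENNReal.toReal_ofReal', smul_eq_mul]
  have hmul : ∀ w : Ω → ℝ, Integrable w P → Integrable (fun ω => max (w ω) 0 * g ω) P :=
    fun w hw => hw.pos_part.mul_bdd (c := C) hg.aestronglyMeasurable (Filter.Eventually.of_forall hC)
  rw [withDensityᵥ_eq_withDensity_pos_part_sub_withDensity_neg_part hu,
    VectorMeasure.integral_sub_vectorMeasure (hint _) (hint _), hflip,
    VectorMeasure.integral_toSignedMeasure, VectorMeasure.integral_toSignedMeasure,
    hdens u hu, hdens (fun ω => - u ω) hu.neg,
    ← integral_sub (hmul u hu) (hmul (fun ω => - u ω) hu.neg)]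
  refine integral_congr_ae (Filter.Eventually.of_forall fun ω => ?_)
  have : max (u ω) 0 - max (-u ω) 0 = u ω := max_zero_sub_max_neg_zero_eq_self (u ω)
  simp only [← sub_mul, this]

/-- With `c = -λ⁻¹` this is already the multiplier identity, so once `f''` is recognized as a
residual measure nothing remains to be shown for that `τ`. -/
theorem integral_residualMeasure (hX2 : MemLp X 2 P) (hτ : Measurable τ) (c : ℝ) {g : I → E d}
    (hg : Measurable g) {C : ℝ} (hC : ∀ t, ‖g t‖ ≤ C) :
    (residualMeasure P X f τ c).integral g = c * ∫ ω, ⟪X ω - f (τ ω), g (τ ω)⟫ ∂P := by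
  have hgj : ∀ j, Measurable fun t => g t j := fun j =>
    (EuclideanSpace.proj (𝕜 := ℝ) j).continuous.measurable.comp hg
  have hgC : ∀ j t, |g t j| ≤ C := fun j t => (PiLp.norm_apply_le (g t) j).trans (hC t)
  have hint : ∀ j, Integrable (fun ω => (X ω - f (τ ω)) j * g (τ ω) j) P := fun j =>
    (integrable_residual_apply hX2 hτ j).mul_bdd (c := C) ((hgj j).comp hτ).aestronglyMeasurable
      (Filter.Eventually.of_forall fun ω => hgC j (τ ω))
  have h1 : ∀ j, VectorMeasure.integral (residualMeasure P X f τ c j) (fun t => g t j)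
      (ContinuousLinearMap.lsmul ℝ ℝ) = c * ∫ ω, (X ω - f (τ ω)) j * g (τ ω) j ∂P := by
    intro j
    have hu := integrable_residual_apply (f := f) hX2 hτ j
    have hfin : IsFiniteMeasure (P.withDensityᵥ fun ω => (X ω - f (τ ω)) j).variation := by
      rw [Measure.variation_withDensityᵥ hu]
      exact ⟨by simpa using! hu.2⟩
    rw [residualMeasure, VectorMeasure.integral_smul_vectorMeasure, VectorMeasure.integral_map hτ
      (hgj j).aestronglyMeasurable (Integrable.of_bound ((hgj j).comp hτ).aestronglyMeasurable C
        (Filter.Eventually.of_forall fun ω => hgC j (τ ω))),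
      smul_eq_mul]
    exact congrArg (c * ·) (integral_withDensityᵥ hu ((hgj j).comp hτ) fun ω => hgC j (τ ω))
  rw [VecSignedMeasure.integral, Finset.sum_congr rfl fun j _ => h1 j, ← Finset.mul_sum,
    ← integral_finsetSum _ fun j _ => hint j]
  congr 1
  refine integral_congr_ae (Filter.Eventually.of_forall fun ω => ?_)
  simp only [PiLp.inner_apply, RCLike.inner_apply, conj_trivial, mul_comm]

end PrincipalCurve

/-! ### Consequences of a vanishing multiplier -/

namespace PrincipalCurve

variable {Ω : Type*} [MeasurableSpace Ω] {P : Measure Ω} [IsProbabilityMeasure P] {d : ℕ}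
  {X : Ω → E d} {f : C(I, E d)} {τ : Ω → I} {κ : CurveKind} {L : ℝ}

@[simp] theorem extend_coe (f : C(I, E d)) (t : I) : extend f t = f t :=
  Set.IccExtend_val _ _ _

theorem hasDerivWithinAt_smul_extend_right (hX2 : MemLp X 2 P) (hτ : Measurable τ) {lam : ℝ}
    (h : ∀ s : I, kinkMoment P X f κ τ s = lam • (f s - f 0)) {t : I} (ht : t < 1) :
    HasDerivWithinAt (fun s => lam • (extend f s - f 0))
      (residualMass P X f τ (Ioi t) - momentDrift P X f κ τ) (Ioi (t : ℝ)) t := by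
  have heq : ∀ s ∈ Icc (0 : ℝ) 1, lam • (extend f s - f 0) = kinkMoment P X f κ τ s :=
    fun s hs => by rw [h ⟨s, hs⟩, ← extend_coe f ⟨s, hs⟩]
  refine (hasDerivWithinAt_kinkMoment_right hX2 hτ t).congr_of_eventuallyEq ?_ (heq t t.2)
  have ht' : (t : ℝ) < 1 := ht
  filter_upwards [Ioo_mem_nhdsGT ht'] with s hs
  exact heq s ⟨t.2.1.trans hs.1.le, hs.2.le⟩

theorem hasDerivWithinAt_smul_extend_left (hX2 : MemLp X 2 P) (hτ : Measurable τ) {lam : ℝ}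
    (h : ∀ s : I, kinkMoment P X f κ τ s = lam • (f s - f 0)) {t : I} (ht : 0 < t) :
    HasDerivWithinAt (fun s => lam • (extend f s - f 0))
      (residualMass P X f τ (Ici t) - momentDrift P X f κ τ) (Iio (t : ℝ)) t := by
  have heq : ∀ s ∈ Icc (0 : ℝ) 1, lam • (extend f s - f 0) = kinkMoment P X f κ τ s :=
    fun s hs => by rw [h ⟨s, hs⟩, ← extend_coe f ⟨s, hs⟩]
  refine (hasDerivWithinAt_kinkMoment_left hX2 hτ t).congr_of_eventuallyEq ?_ (heq t t.2)
  have ht' : (0 : ℝ) < t := ht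
  filter_upwards [Ioo_mem_nhdsLT ht'] with s hs
  exact heq s ⟨hs.1.le, hs.2.le.trans t.2.2⟩

theorem Ioi_one_eq_empty : Ioi (1 : I) = ∅ := by
  ext t
  simp [unitInterval.le_one']

theorem isPiSystem_range_Ioi : IsPiSystem (range (Ioi : I → Set I)) := by
  rintro _ ⟨a, rfl⟩ _ ⟨b, rfl⟩ _
  exact ⟨a ⊔ b, (Ioi_inter_Ioi).symm⟩

/-- Two signed measures on `[0,1]` with the same total mass which agree on all `(s,1]` are equal. -/
theorem signedMeasure_ext_Ioi {μ ν : SignedMeasure I} (huniv : μ univ = ν univ)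
    (hIoi : ∀ t : I, μ (Ioi t) = ν (Ioi t)) : μ = ν := by
  refine VectorMeasure.ext_of_generateFrom (range Ioi) ?_
    (BorelSpace.measurable_eq.trans (borel_eq_generateFrom_Ioi I)) isPiSystem_range_Ioi huniv
  rintro _ ⟨t, rfl⟩
  exact hIoi t

/-- If the multiplier vanishes, the residual is orthogonal to all functions of `τ`. -/
theorem integral_inner_eq_zero (hX2 : MemLp X 2 P) (hτ : Measurable τ)
    (hmean : ∫ ω, (X ω - f (τ ω)) ∂P = 0)
    (hτ1 : κ = CurveKind.closedCurves → ∀ ω, τ ω ≠ 1)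
    (h : ∀ s : I, kinkMoment P X f κ τ s = 0) {g : I → E d} (hg : Measurable g) {C : ℝ}
    (hC : ∀ t, ‖g t‖ ≤ C) : ∫ ω, ⟪X ω - f (τ ω), g (τ ω)⟫ ∂P = 0 := by
  have h' : ∀ s : I, kinkMoment P X f κ τ s = (0 : ℝ) • (f s - f 0) := fun s => by
    rw [h s, zero_smul]
  have hright : ∀ t : I, t < 1 → residualMass P X f τ (Ioi t) = momentDrift P X f κ τ := by
    intro t ht
    have h1 := hasDerivWithinAt_smul_extend_right hX2 hτ h' ht
    simp only [zero_smul] at h1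
    exact sub_eq_zero.1 ((uniqueDiffWithinAt_Ioi (t : ℝ)).eq_deriv _ h1
      (hasDerivWithinAt_const _ _ _))
  -- The left derivative at `1` identifies the drift with the mass at `1`; this mass is zero for
  -- closed curves, where `τ` avoids `1`.
  have hleft : residualMass P X f τ (Ici 1) = momentDrift P X f κ τ := by
    have h1 := hasDerivWithinAt_smul_extend_left hX2 hτ h' (t := 1) zero_lt_one
    simp only [zero_smul] at h1
    exact sub_eq_zero.1 ((uniqueDiffWithinAt_Iio ((1 : I) : ℝ)).eq_deriv _ h1
      (hasDerivWithinAt_const _ _ _))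
  have hdrift : momentDrift P X f κ τ = 0 := by
    cases κ
    · simp [momentDrift, closedWeight]
    · rw [← hleft, residualMass]
      have : τ ⁻¹' Ici 1 = ∅ := by
        ext ω
        simpa using lt_of_le_of_ne unitInterval.le_one' (hτ1 rfl ω)
      rw [this, setIntegral_empty]
  have hIoi : ∀ t : I, residualMass P X f τ (Ioi t) = 0 := by
    intro t
    rcases eq_or_lt_of_le (unitInterval.le_one' : t ≤ 1) with rfl | ht
    · rw [Ioi_one_eq_empty, residualMass, preimage_empty, setIntegral_empty]
    · rw [hright t ht, hdrift]
  have hval : ∀ A : Set I, MeasurableSet A → residualMass P X f τ A = 0 → ∀ j,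
      residualMeasure P X f τ 1 j A = 0 := by
    intro A hA h0 j
    have := value_residualMeasure (f := f) hX2 hτ 1 hA
    rw [h0, smul_zero] at this
    exact congrArg (fun v : E d => v j) this
  have hzero : ∀ j, residualMeasure P X f τ 1 j = 0 := fun j =>
    signedMeasure_ext_Ioi (hval univ .univ (by rw [residualMass_univ, hmean]) j)
      (fun t => hval _ measurableSet_Ioi (hIoi t) j)
  have h1 := integral_residualMeasure (f := f) hX2 hτ 1 hg hC
  rw [one_mul] at h1
  rw [← h1, VecSignedMeasure.integral]
  simp [hzero]

end PrincipalCurve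

/-! ### Comparison with a contracted and spiked curve -/

namespace PrincipalCurve

section Tent

/-- The tent function of height `1` with support `[a - δ, a + δ]`. -/
noncomputable def tent (a δ t : ℝ) : ℝ := 1 - |max (a - δ) (min t (a + δ)) - a| / δ

theorem continuous_tent (a δ : ℝ) : Continuous (tent a δ) := by
  unfold tent; fun_prop

theorem tent_self {a δ : ℝ} (hδ : 0 < δ) : tent a δ a = 1 := by
  rw [tent, min_eq_left (by linarith), max_eq_right (by linarith)]; simp

theorem tent_eq_zero {a δ t : ℝ} (hδ : 0 < δ) (h : δ ≤ |t - a|) : tent a δ t = 0 := by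
  rcases le_abs'.1 h with h | h
  · rw [tent, min_eq_left (by linarith), max_eq_left (by linarith), sub_sub_cancel_left, abs_neg,
      abs_of_pos hδ, div_self hδ.ne', sub_self]
  · rw [tent, min_eq_right (by linarith), max_eq_right (by linarith), add_sub_cancel_left,
      abs_of_pos hδ, div_self hδ.ne', sub_self]

theorem tent_mem {a δ : ℝ} (hδ : 0 < δ) (t : ℝ) : tent a δ t ∈ Icc (0 : ℝ) 1 := by
  have h1 : |max (a - δ) (min t (a + δ)) - a| ≤ δ := by
    rw [abs_le]
    constructor
    · linarith [le_max_left (a - δ) (min t (a + δ))]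
    · linarith [max_le (show a - δ ≤ a + δ by linarith) (min_le_right t (a + δ))]
  have h2 : |max (a - δ) (min t (a + δ)) - a| / δ ≤ 1 := (div_le_one hδ).2 h1
  have h3 : 0 ≤ |max (a - δ) (min t (a + δ)) - a| / δ := by positivity
  constructor <;> rw [tent] <;> linarith

variable {d : ℕ}

/-- A spike in direction `u` at the parameter `a`. -/
noncomputable def spike (a δ : ℝ) (u : E d) : C(I, E d) where
  toFun t := tent a δ t • u
  continuous_toFun := ((continuous_tent a δ).comp continuous_subtype_val).smul continuous_const

/-- The spike runs out to `u` and back. The bound does not depend on the width `δ`, so the width may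
tend to zero. -/
theorem length_spike_le {a δ : ℝ} (hδ : 0 < δ) (u : E d) :
    length (spike a δ u) ≤ ENNReal.ofReal (2 * ‖u‖) := by
  refine (eVariationOn_le_of_dominated (d := d) _
    (fun t => max (a - δ) (min t (a + δ)) / δ * ‖u‖) ?_).trans (ENNReal.ofReal_le_ofReal ?_)
  · intro s t hst
    have hst' : (s : ℝ) ≤ t := hst
    have hm : max (a - δ) (min (s : ℝ) (a + δ)) ≤ max (a - δ) (min (t : ℝ) (a + δ)) :=
      max_le_max le_rfl (min_le_min hst' le_rfl)
    change ‖tent a δ t • u - tent a δ s • u‖ ≤ _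
    rw [← sub_smul, norm_smul, ← sub_mul, ← sub_div]
    gcongr
    rw [tent, tent, sub_sub_sub_cancel_left, ← sub_div, norm_div, Real.norm_eq_abs, Real.norm_eq_abs,
      abs_of_pos hδ]
    gcongr
    refine (abs_abs_sub_abs_le _ _).trans ?_
    rw [sub_sub_sub_cancel_right, abs_sub_comm, abs_of_nonneg (by linarith)]
  · rw [← sub_mul, ← sub_div]
    gcongr
    rw [div_le_iff₀ hδ]
    have h1 := max_le (show a - δ ≤ a + δ by linarith) (min_le_right ((1 : I) : ℝ) (a + δ))
    have h2 := le_max_left (a - δ) (min ((0 : I) : ℝ) (a + δ))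
    linarith

end Tent

variable {Ω : Type*} [MeasurableSpace Ω] {P : Measure Ω} [IsProbabilityMeasure P] {d : ℕ}
  {X : Ω → E d} {f : C(I, E d)} {τ : Ω → I} {κ : CurveKind} {L : ℝ}

/-- Contraction frees length `ε ℓ`, which together with the slack `L - ℓ` pays for the spike. The
support of the spike meets the endpoints at height zero, so closedness survives. -/
theorem spiked_mem_curveClass (hf : f ∈ curveClass κ d L) {ℓ ε : ℝ} (hℓ0 : 0 ≤ ℓ)
    (hℓ : length f ≤ ENNReal.ofReal ℓ) (hε1 : ε ≤ 1) {u : E d}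
    (hu : (1 - ε) * ℓ + 2 * ‖u‖ ≤ L) {a δ : ℝ} (hδ : 0 < δ) (h0 : δ ≤ a) (h1 : a + δ ≤ 1) :
    (1 - ε) • f + spike a δ u ∈ curveClass κ d L := by
  refine ⟨?_, fun h => ?_⟩
  · refine (length_add_le _ _).trans ((add_le_add ((length_smul_le _ _).trans
      (mul_le_mul_right hℓ _)) (length_spike_le hδ u)).trans ?_)
    rw [abs_of_nonneg (by linarith), ← ENNReal.ofReal_mul (by linarith),
      ← ENNReal.ofReal_add (mul_nonneg (by linarith) hℓ0) (by positivity)]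
    exact ENNReal.ofReal_le_ofReal hu
  · have e0 : spike a δ u 0 = 0 := by
      change tent a δ ((0 : I) : ℝ) • u = 0
      rw [tent_eq_zero hδ, zero_smul]
      simpa using h0.trans (le_abs_self a)
    have e1 : spike a δ u 1 = 0 := by
      change tent a δ ((1 : I) : ℝ) • u = 0
      rw [tent_eq_zero hδ, zero_smul]
      simpa using (by linarith : δ ≤ 1 - a).trans (le_abs_self (1 - a))
    simp [hf.2 h, e0, e1]

/-- Harm done to a sample that keeps its parameter: proportional to the tent height there, hence
negligible for thin spikes. -/
theorem norm_sub_smul_sq_le {V : Type*} [NormedAddCommGroup V] [InnerProductSpace ℝ V] (z u : V)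
    {φ : ℝ} (hφ : φ ∈ Icc (0 : ℝ) 1) :
    ‖z - φ • u‖ ^ 2 ≤ ‖z‖ ^ 2 + φ * (2 * (‖z‖ * ‖u‖) + ‖u‖ ^ 2) := by
  rw [norm_sub_sq_real, inner_smul_right, norm_smul, mul_pow, Real.norm_eq_abs, sq_abs]
  have h1 : -(‖z‖ * ‖u‖) ≤ ⟪z, u⟫ := (abs_le.1 (abs_real_inner_le_norm z u)).1
  have h2 : φ * -(‖z‖ * ‖u‖) ≤ φ * ⟪z, u⟫ := mul_le_mul_of_nonneg_left h1 hφ.1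
  have h3 : φ ^ 2 * ‖u‖ ^ 2 ≤ φ * ‖u‖ ^ 2 := by
    gcongr
    nlinarith [hφ.1, hφ.2]
  linarith

/-- Gain of a sample redirected to the tip of the spike, `w` being its displacement relative to the
contracted curve. -/
theorem norm_add_smul_sub_sq_le {V : Type*} [NormedAddCommGroup V] [InnerProductSpace ℝ V]
    (y p w : V) {ε M B : ℝ} (hε : 0 ≤ ε) (hp : ‖p‖ ≤ M)
    (hB : 2 * ε * M * ‖w‖ + ‖w‖ ^ 2 ≤ B) :
    ‖y + ε • p - w‖ ^ 2 ≤ ‖y + ε • p‖ ^ 2 - (2 * ⟪y, w⟫ - B) := by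
  rw [norm_sub_sq_real, inner_add_left, real_inner_smul_left]
  have h1 : -(M * ‖w‖) ≤ ⟪p, w⟫ := (neg_le_neg (mul_le_mul_of_nonneg_right hp (norm_nonneg w))).trans
    (abs_le.1 (abs_real_inner_le_norm p w)).1
  have h2 : ε * -(M * ‖w‖) ≤ ε * ⟪p, w⟫ := mul_le_mul_of_nonneg_left h1 hε
  linarith

/-- Comparison of an optimal curve whose residual is orthogonal to all functions of `τ` with a
slightly contracted curve with a spike of width `δ`. -/
theorem spike_bound_width (hX2 : MemLp X 2 P) (hτ : IsNearest P X f τ) (hf : IsOptimal P X κ L f)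
    (hnull : ∀ g : I → E d, Measurable g → (∃ C : ℝ, ∀ t, ‖g t‖ ≤ C) →
      ∫ ω, ⟪X ω - f (τ ω), g (τ ω)⟫ ∂P = 0)
    {ℓ ε B : ℝ} (hℓ0 : 0 ≤ ℓ) (hℓ : length f ≤ ENNReal.ofReal ℓ) (hε0 : 0 ≤ ε) (hε1 : ε ≤ 1)
    {u : E d} (hu : (1 - ε) * ℓ + 2 * ‖u‖ ≤ L) (a : I) {W : Set I} (hW : MeasurableSet W)
    (hB0 : 0 ≤ B)
    (hB : ∀ t ∈ W, 2 * ε * ‖f‖ * ‖(1 - ε) • (f a - f t) + u‖ + ‖(1 - ε) • (f a - f t) + u‖ ^ 2 ≤ B)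
    {δ : ℝ} (hδ : 0 < δ) (h0 : δ ≤ a) (h1 : a + δ ≤ 1) :
    ∫ ω in τ ⁻¹' W, |⟪X ω - f (τ ω), (1 - ε) • (f a - f (τ ω)) + u⟫| ∂P ≤
      ε ^ 2 * ‖f‖ ^ 2 + B * P.real (τ ⁻¹' W) +
        ∫ ω, tent a δ (τ ω) *
          (2 * (‖X ω - f (τ ω) + ε • f (τ ω)‖ * ‖u‖) + ‖u‖ ^ 2) ∂P := by
  have hτm := hτ.measurable
  set y : Ω → E d := fun ω => X ω - f (τ ω) with hy
  set w : I → E d := fun t => (1 - ε) • (f a - f t) + u with hw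
  have hwc : Continuous w := by rw [hw]; fun_prop
  have hwC : ∃ C : ℝ, ∀ t, ‖w t‖ ≤ C :=
    ⟨‖(⟨w, hwc⟩ : C(I, E d))‖, fun t => (⟨w, hwc⟩ : C(I, E d)).norm_coe_le_norm t⟩
  obtain ⟨C, hC⟩ := hwC
  set N : C(I, E d) := (1 - ε) • f + spike a δ u with hN
  have hinner : Integrable (fun ω => ⟪y ω, w (τ ω)⟫) P :=
    integrable_inner_residual hX2 hτm hwc.measurable hC
  have hyint : Integrable y P := integrable_residual hX2 f hτm
  have hWm : MeasurableSet (τ ⁻¹' W) := hτm hW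
  -- Orthogonality localized to the window: the signed part of the gain integrates to zero, so only
  -- its absolute value remains.
  have hinnerW : ∫ ω in τ ⁻¹' W, ⟪y ω, w (τ ω)⟫ ∂P = 0 := by
    rw [← integral_indicator hWm, ← hnull (W.indicator w) (hwc.measurable.indicator hW)
      ⟨C, fun t => (norm_indicator_le_norm_self _ _).trans (hC t)⟩]
    refine integral_congr_ae (Filter.Eventually.of_forall fun ω => ?_)
    by_cases h : τ ω ∈ W
    · simp [h, y]
    · simp [h]
  -- Orthogonality of the residual to `f (τ ω)` kills the first-order cost of the contraction.
  have hbase : ∫ ω, ‖y ω + ε • f (τ ω)‖ ^ 2 ∂P ≤ criterion P X f + ε ^ 2 * ‖f‖ ^ 2 := by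
    have := integral_norm_sub_smul_sq (f := f) hX2 hτm f (-ε)
    simp only [neg_smul, sub_neg_eq_add, neg_sq] at this
    rw [this, hnull f f.continuous.measurable ⟨_, f.norm_coe_le_norm⟩, mul_zero, sub_zero,
      criterion_eq hτ]
    gcongr
    calc ∫ ω, ‖f (τ ω)‖ ^ 2 ∂P ≤ ∫ _, ‖f‖ ^ 2 ∂P := by
          refine integral_mono_of_nonneg (Filter.Eventually.of_forall fun ω => by positivity)
            (integrable_const _) (Filter.Eventually.of_forall fun ω => ?_)
          exact pow_le_pow_left₀ (norm_nonneg _) (f.norm_coe_le_norm (τ ω)) 2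
      _ = ‖f‖ ^ 2 := by simp
  set z : Ω → E d := fun ω => y ω + ε • f (τ ω) with hz
  have hz2 : MemLp z 2 P := (memLp_residual hX2 f hτm).add ((memLp_comp f hτm 2).const_smul ε)
  have hzint : Integrable (fun ω => ‖z ω‖ ^ 2) P := hz2.integrable_norm_pow (by norm_num)
  set R : Ω → ℝ := fun ω => tent a δ (τ ω) * (2 * (‖z ω‖ * ‖u‖) + ‖u‖ ^ 2) with hR
  have hRint : Integrable R P := by
    refine Integrable.bdd_mul (c := 1) ((((hz2.integrable (by norm_num)).norm.mul_const _).const_mul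
      _).add (integrable_const _)) (((continuous_tent _ _).measurable.comp
      (measurable_subtype_coe.comp hτm)).aestronglyMeasurable)
      (Filter.Eventually.of_forall fun ω => ?_)
    have := tent_mem (a := a) hδ (τ ω)
    rw [Real.norm_eq_abs, abs_of_nonneg this.1]
    exact this.2
  -- `S` collects the samples in the window that profit from moving to the tip. A measurable version
  -- of the residual makes `S`, and hence the new parameter choice `ρ`, measurable.
  obtain ⟨y', hy'm, hy'⟩ := hyint.aestronglyMeasurable.aemeasurable
  set S : Set Ω := τ ⁻¹' W ∩ {ω | B < 2 * ⟪y' ω, w (τ ω)⟫} with hS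
  have hSm : MeasurableSet S := hWm.inter
    (measurableSet_lt measurable_const ((hy'm.inner (hwc.measurable.comp hτm)).const_mul 2))
  classical
  set ρ : Ω → I := fun ω => if ω ∈ S then a else τ ω with hρ
  have hρm : Measurable ρ := Measurable.ite hSm measurable_const hτm
  -- On `S` this is the guaranteed gain `2⟪y, w⟫ - B`; off `S` it is nonpositive, so subtracting it
  -- is harmless.
  set Q : Ω → ℝ := (τ ⁻¹' W).indicator fun ω => |⟪y ω, w (τ ω)⟫| + ⟪y ω, w (τ ω)⟫ - B with hQ
  have hQint : Integrable Q P := ((hinner.abs.add hinner).sub (integrable_const B)).indicator hWm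
  have hpoint : ∀ᵐ ω ∂P, ‖X ω - N (ρ ω)‖ ^ 2 ≤ ‖z ω‖ ^ 2 - Q ω + R ω := by
    filter_upwards [hy'] with ω hω
    have hRnn : 0 ≤ R ω := mul_nonneg (tent_mem hδ _).1 (by positivity)
    by_cases hωS : ω ∈ S
    · have hωW : ω ∈ τ ⁻¹' W := hωS.1
      have hgt : B < 2 * ⟪y ω, w (τ ω)⟫ := by rw [hω]; exact hωS.2
      have e1 : X ω - N (ρ ω) = y ω + ε • f (τ ω) - w (τ ω) := by
        have : spike a δ u a = u := by
          change tent a δ a • u = u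
          rw [tent_self hδ, one_smul]
        simp only [hρ, if_pos hωS, hN, hy, hw, ContinuousMap.add_apply, ContinuousMap.smul_apply,
          this, smul_sub, sub_smul, one_smul]
        abel
      rw [e1, hQ, indicator_of_mem hωW]
      have h2 := norm_add_smul_sub_sq_le (y ω) (f (τ ω)) (w (τ ω)) hε0 (f.norm_coe_le_norm (τ ω))
        (hB (τ ω) hωW)
      have h3 : |⟪y ω, w (τ ω)⟫| = ⟪y ω, w (τ ω)⟫ := abs_of_nonneg (by linarith)
      rw [h3]
      simp only [hz]
      linarith
    · have e1 : X ω - N (ρ ω) = z ω - tent a δ (τ ω) • u := by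
        have : spike a δ u (τ ω) = tent a δ (τ ω) • u := rfl
        simp only [hρ, if_neg hωS, hN, hz, hy, ContinuousMap.add_apply, ContinuousMap.smul_apply,
          this, sub_smul, one_smul]
        abel
      rw [e1]
      have h2 := norm_sub_smul_sq_le (z ω) u (tent_mem (a := a) hδ (τ ω))
      have h3 : Q ω ≤ 0 := by
        by_cases hωW : ω ∈ τ ⁻¹' W
        · rw [hQ, indicator_of_mem hωW]
          have hle : 2 * ⟪y ω, w (τ ω)⟫ ≤ B := by
            by_contra! hcon
            exact hωS ⟨hωW, by rw [hω] at hcon; exact hcon⟩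
          rcases abs_cases ⟪y ω, w (τ ω)⟫ with h | h <;> linarith
        · rw [hQ, indicator_of_notMem hωW]
      simp only [hR]
      linarith
  have hcomp : criterion P X f ≤ ∫ ω, (‖z ω‖ ^ 2 - Q ω + R ω) ∂P :=
    ((hf.le N (spiked_mem_curveClass hf.mem hℓ0 hℓ hε1 hu hδ h0 h1)).trans
      (criterion_le hX2 N hρm)).trans (integral_mono_ae
        ((memLp_residual hX2 N hρm).integrable_norm_pow (by norm_num))
        ((hzint.sub hQint).add hRint) hpoint)
  have hQval : ∫ ω, Q ω ∂P = (∫ ω in τ ⁻¹' W, |⟪y ω, w (τ ω)⟫| ∂P) - B * P.real (τ ⁻¹' W) := by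
    have hA : Integrable (fun ω => |⟪y ω, w (τ ω)⟫| + ⟪y ω, w (τ ω)⟫) P := hinner.abs.add hinner
    rw [hQ, integral_indicator hWm, integral_sub hA.integrableOn (integrable_const B), integral_add hinner.abs.integrableOn hinner.integrableOn, hinnerW,
      add_zero, integral_const, smul_eq_mul, measureReal_restrict_apply_univ, mul_comm B]
  have hD : Integrable (fun ω => ‖z ω‖ ^ 2 - Q ω) P := hzint.sub hQint
  rw [integral_add hD hRint, integral_sub hzint hQint, hQval] at hcomp
  linarith

end PrincipalCurve

/-! ### Maximal length and positivity of the multiplier -/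

namespace PrincipalCurve

variable {Ω : Type*} [MeasurableSpace Ω] {P : Measure Ω} [IsProbabilityMeasure P] {d : ℕ}
  {X : Ω → E d} {f : C(I, E d)} {τ : Ω → I} {κ : CurveKind} {L : ℝ}

/-- Comparison of an optimal curve whose residual is orthogonal to all functions of `τ` with a
slightly contracted curve with an infinitely thin spike. -/
theorem spike_bound (hX2 : MemLp X 2 P) (hτ : IsNearest P X f τ) (hf : IsOptimal P X κ L f)
    (hnull : ∀ g : I → E d, Measurable g → (∃ C : ℝ, ∀ t, ‖g t‖ ≤ C) →
      ∫ ω, ⟪X ω - f (τ ω), g (τ ω)⟫ ∂P = 0)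
    {ℓ ε B : ℝ} (hℓ0 : 0 ≤ ℓ) (hℓ : length f ≤ ENNReal.ofReal ℓ) (hε0 : 0 ≤ ε) (hε1 : ε ≤ 1)
    {u : E d} (hu : (1 - ε) * ℓ + 2 * ‖u‖ ≤ L) {a : I} (ha0 : 0 < (a : ℝ)) (ha1 : (a : ℝ) < 1)
    (ha : P {ω | τ ω = a} = 0) {W : Set I} (hW : MeasurableSet W) (hB0 : 0 ≤ B)
    (hB : ∀ t ∈ W,
      2 * ε * ‖f‖ * ‖(1 - ε) • (f a - f t) + u‖ + ‖(1 - ε) • (f a - f t) + u‖ ^ 2 ≤ B) :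
    ∫ ω in τ ⁻¹' W, |⟪X ω - f (τ ω), (1 - ε) • (f a - f (τ ω)) + u⟫| ∂P ≤
      ε ^ 2 * ‖f‖ ^ 2 + B * P.real (τ ⁻¹' W) := by
  have hτm := hτ.measurable
  set R : Ω → ℝ := fun ω => 2 * (‖X ω - f (τ ω) + ε • f (τ ω)‖ * ‖u‖) + ‖u‖ ^ 2 with hR
  have hz2 : MemLp (fun ω => X ω - f (τ ω) + ε • f (τ ω)) 2 P :=
    (memLp_residual hX2 f hτm).add ((memLp_comp f hτm 2).const_smul ε)
  have hRint : Integrable R P :=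
    (((hz2.integrable (by norm_num)).norm.mul_const _).const_mul _).add (integrable_const _)
  -- The tents shrink to the indicator of `{a}`, which `τ` almost surely avoids.
  have hlim : Filter.Tendsto (fun δ : ℝ => ∫ ω, tent a δ (τ ω) * R ω ∂P) (nhdsWithin 0 (Ioi 0))
      (nhds (∫ _, (0 : ℝ) ∂P)) := by
    refine tendsto_integral_filter_of_dominated_convergence R
      (Filter.Eventually.of_forall fun δ => ((continuous_tent _ _).measurable.comp
        (measurable_subtype_coe.comp hτm)).aestronglyMeasurable.mul hRint.aestronglyMeasurable)
      ?_ hRint ?_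
    · filter_upwards [self_mem_nhdsWithin] with δ hδ
      refine Filter.Eventually.of_forall fun ω => ?_
      have h1 := tent_mem (a := a) hδ (τ ω)
      have h2 : 0 ≤ R ω := by positivity
      rw [Real.norm_eq_abs, abs_of_nonneg (mul_nonneg h1.1 h2)]
      exact mul_le_of_le_one_left h2 h1.2
    · have hne : ∀ᵐ ω ∂P, τ ω ≠ a := by rw [ae_iff]; simpa using ha
      filter_upwards [hne] with ω hω
      have hpos : 0 < |(τ ω : ℝ) - a| := abs_pos.2 (sub_ne_zero.2 fun h => hω (Subtype.ext h))
      refine tendsto_const_nhds.congr' ?_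
      filter_upwards [Ioo_mem_nhdsGT hpos] with δ hδ
      rw [tent_eq_zero hδ.1 hδ.2.le, zero_mul]
  rw [integral_zero] at hlim
  have hlim' := hlim.const_add (ε ^ 2 * ‖f‖ ^ 2 + B * P.real (τ ⁻¹' W))
  rw [add_zero] at hlim'
  refine ge_of_tendsto hlim' ?_
  have hmin : 0 < min (a : ℝ) (1 - a) := lt_min ha0 (by linarith)
  filter_upwards [Ioo_mem_nhdsGT hmin] with δ hδ
  have h1 : δ < a := hδ.2.trans_le (min_le_left _ _)
  have h2 : δ < 1 - a := hδ.2.trans_le (min_le_right _ _)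
  exact spike_bound_width hX2 hτ hf hnull hℓ0 hℓ hε0 hε1 hu a hW hB0 hB hδ.1 h1.le (by linarith)

/-- Two opposite spikes `±h e` along the basis vector `e` are tried. Adding the bounds eliminates
the uncontrolled term `(1 - ε)(f a - f τ)` through `|2q| ≤ |p + q| + |p - q|`. -/
theorem spike_bound_coordinate (hX2 : MemLp X 2 P) (hτ : IsNearest P X f τ)
    (hf : IsOptimal P X κ L f)
    (hnull : ∀ g : I → E d, Measurable g → (∃ C : ℝ, ∀ t, ‖g t‖ ≤ C) →
      ∫ ω, ⟪X ω - f (τ ω), g (τ ω)⟫ ∂P = 0)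
    {ℓ ε h η : ℝ} (hℓ0 : 0 ≤ ℓ) (hℓ : length f ≤ ENNReal.ofReal ℓ) (hε0 : 0 ≤ ε) (hε1 : ε ≤ 1)
    (hh : 0 < h) (hη : 0 ≤ η) (hhL : (1 - ε) * ℓ + 2 * h ≤ L) (j : Fin d) {a : I}
    (ha0 : 0 < (a : ℝ)) (ha1 : (a : ℝ) < 1) (ha : P {ω | τ ω = a} = 0) {W : Set I}
    (hW : MeasurableSet W) (hWη : ∀ t ∈ W, ‖f a - f t‖ ≤ η) :
    h * ∫ ω in τ ⁻¹' W, |(X ω - f (τ ω)) j| ∂P ≤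
      ε ^ 2 * ‖f‖ ^ 2 + (2 * ε * ‖f‖ * (η + h) + (η + h) ^ 2) * P.real (τ ⁻¹' W) := by
  have hτm := hτ.measurable
  set e : E d := EuclideanSpace.single j 1 with he
  have hen : ‖e‖ = 1 := by simp [he]
  have hinn : ∀ ω, ⟪X ω - f (τ ω), e⟫ = (X ω - f (τ ω)) j := fun ω => by
    rw [real_inner_comm, he, EuclideanSpace.inner_single_left]; simp
  have main : ∀ u : E d, ‖u‖ = h →
      ∫ ω in τ ⁻¹' W, |⟪X ω - f (τ ω), (1 - ε) • (f a - f (τ ω)) + u⟫| ∂P ≤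
      ε ^ 2 * ‖f‖ ^ 2 + (2 * ε * ‖f‖ * (η + h) + (η + h) ^ 2) * P.real (τ ⁻¹' W) := by
    intro u hu
    refine spike_bound hX2 hτ hf hnull hℓ0 hℓ hε0 hε1 (by rw [hu]; exact hhL) ha0 ha1 ha hW
      (by positivity) fun t ht => ?_
    have h1 : ‖(1 - ε) • (f a - f t) + u‖ ≤ η + h := by
      refine (norm_add_le _ _).trans (add_le_add ?_ hu.le)
      rw [norm_smul, Real.norm_eq_abs, abs_of_nonneg (by linarith)]
      exact (mul_le_of_le_one_left (norm_nonneg _) (by linarith)).trans (hWη t ht)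
    gcongr
  have hint : ∀ u : E d,
      Integrable (fun ω => |⟪X ω - f (τ ω), (1 - ε) • (f a - f (τ ω)) + u⟫|) P := by
    intro u
    have hc : Continuous fun t => (1 - ε) • (f a - f t) + u := by fun_prop
    exact (integrable_inner_residual hX2 hτm hc.measurable
      (ContinuousMap.norm_coe_le_norm ⟨_, hc⟩)).abs
  have hn : ‖h • e‖ = h := by rw [norm_smul, hen, mul_one, Real.norm_eq_abs, abs_of_pos hh]
  have h1 := main (h • e) hn
  have h2 := main (-(h • e)) (by rw [norm_neg, hn])
  have h3 : ∫ ω in τ ⁻¹' W, 2 * h * |(X ω - f (τ ω)) j| ∂P ≤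
      ∫ ω in τ ⁻¹' W, (|⟪X ω - f (τ ω), (1 - ε) • (f a - f (τ ω)) + h • e⟫| +
        |⟪X ω - f (τ ω), (1 - ε) • (f a - f (τ ω)) + -(h • e)⟫|) ∂P := by
    refine integral_mono_ae ((integrable_residual_apply hX2 hτm j).abs.const_mul _).integrableOn
      ((hint _).add (hint _)).integrableOn (Filter.Eventually.of_forall fun ω => ?_)
    simp only [inner_add_right, inner_neg_right, inner_smul_right, hinn]
    have h4 : 2 * h * |(X ω - f (τ ω)) j| = |2 * (h * (X ω - f (τ ω)) j)| := by
      rw [← mul_assoc, abs_mul, abs_of_pos (by positivity : 0 < 2 * h)]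
    rw [h4]
    set p := (1 - ε) * ⟪X ω - f (τ ω), f a - f (τ ω)⟫
    set q := h * (X ω - f (τ ω)) j
    calc |2 * q| = |(p + q) - (p + -q)| := by congr 1; ring
      _ ≤ |p + q| + |p + -q| := abs_sub _ _
  rw [integral_const_mul, integral_add (hint _).integrableOn (hint _).integrableOn] at h3
  linarith

/-- Summing the spike bounds over windows of width `1 / N`. -/
theorem spike_bound_windows (hX2 : MemLp X 2 P) (hτ : IsNearest P X f τ) (hf : IsOptimal P X κ L f)
    (hnull : ∀ g : I → E d, Measurable g → (∃ C : ℝ, ∀ t, ‖g t‖ ≤ C) →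
      ∫ ω, ⟪X ω - f (τ ω), g (τ ω)⟫ ∂P = 0)
    {ℓ ε h η : ℝ} (hℓ0 : 0 ≤ ℓ) (hℓ : length f ≤ ENNReal.ofReal ℓ) (hε0 : 0 ≤ ε) (hε1 : ε ≤ 1)
    (hh : 0 < h) (hη : 0 ≤ η) (hhL : (1 - ε) * ℓ + 2 * h ≤ L) (j : Fin d) {N : ℕ} (hN : 0 < N)
    (hNη : ∀ s t : I, |(s : ℝ) - t| ≤ 1 / N → ‖f s - f t‖ ≤ η) :
    h * ∫ ω, |(X ω - f (τ ω)) j| ∂P ≤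
      (N + 1) * (ε ^ 2 * ‖f‖ ^ 2) + (2 * ε * ‖f‖ * (η + h) + (η + h) ^ 2) := by
  have hτm := hτ.measurable
  have hN' : (0 : ℝ) < N := by exact_mod_cast hN
  set B := 2 * ε * ‖f‖ * (η + h) + (η + h) ^ 2 with hB
  -- The window of index `N` contains only `t = 1`, which accounts for `N + 1` windows. It borrows
  -- the base interval of index `N - 1`, so that the spike can sit strictly inside `(0,1)`.
  set W : ℕ → Set I := fun i => {t | ⌊(N : ℝ) * t⌋₊ = i} with hW
  have hWm : ∀ i, MeasurableSet (W i) := fun i =>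
    (Nat.measurable_floor.comp (measurable_subtype_coe.const_mul (N : ℝ))) (measurableSet_singleton i)
  have hwin : ∀ i ∈ Finset.range (N + 1),
      ∫ ω in τ ⁻¹' W i, (h * |(X ω - f (τ ω)) j| - B) ∂P ≤ ε ^ 2 * ‖f‖ ^ 2 := by
    intro i hi
    have hiN : i ≤ N := Nat.lt_succ_iff.1 (Finset.mem_range.1 hi)
    obtain ⟨k, hkN, hk⟩ : ∃ k : ℕ, k + 1 ≤ N ∧ ∀ t ∈ W i, (k : ℝ) ≤ N * t ∧ N * (t : ℝ) ≤ k + 1 := by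
      have hfl : ∀ t ∈ W i, (i : ℝ) ≤ N * t ∧ N * (t : ℝ) < i + 1 := by
        intro t ht
        have h0 : 0 ≤ (N : ℝ) * t := mul_nonneg hN'.le t.2.1
        exact (Nat.floor_eq_iff h0).1 ht
      rcases hiN.lt_or_eq with hlt | rfl
      · exact ⟨i, hlt, fun t ht => ⟨(hfl t ht).1, (hfl t ht).2.le⟩⟩
      · refine ⟨i - 1, by omega, fun t ht => ?_⟩
        have hc : ((i - 1 : ℕ) : ℝ) = i - 1 := by rw [Nat.cast_sub hN]; simp
        rw [hc]
        refine ⟨by linarith [(hfl t ht).1], ?_⟩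
        rw [sub_add_cancel]
        exact mul_le_of_le_one_right hN'.le t.2.2
    have hkN' : (k : ℝ) + 1 ≤ N := by exact_mod_cast hkN
    -- Only countably many parameters are atoms of `τ`, so the base of the spike can avoid them.
    have hcount : ((fun t : I => (t : ℝ)) '' {t | 0 < P {ω | τ ω = t}}).Countable :=
      (Measure.countable_meas_level_set_pos hτm).image _
    obtain ⟨a, haC, ha⟩ := (hcount.dense_compl ℝ).exists_between
      (show (k : ℝ) / N < (k + 1) / N by gcongr; linarith)
    rw [mem_Ioo, div_lt_iff₀ hN', lt_div_iff₀ hN'] at ha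
    have ha0 : 0 < a := by
      have : (0 : ℝ) ≤ k := Nat.cast_nonneg k
      nlinarith [ha.1]
    have ha1 : a < 1 := by nlinarith [ha.2]
    have haP : P {ω | τ ω = ⟨a, ha0.le, ha1.le⟩} = 0 := by
      by_contra hne
      exact haC ⟨⟨a, ha0.le, ha1.le⟩, pos_iff_ne_zero.2 hne, rfl⟩
    have key := spike_bound_coordinate hX2 hτ hf hnull hℓ0 hℓ hε0 hε1 hh hη hhL j
      (a := ⟨a, ha0.le, ha1.le⟩) ha0 ha1 haP (hWm i) (fun t ht => hNη _ _ ?_)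
    · rw [integral_sub ((integrable_residual_apply hX2 hτm j).abs.const_mul h).integrableOn
        (integrable_const B), integral_const_mul, integral_const, smul_eq_mul,
        measureReal_restrict_apply_univ]
      rw [← hB] at key
      linarith
    · have h1 := hk t ht
      change |a - (t : ℝ)| ≤ _
      rw [abs_le, ← neg_div, div_le_iff₀ hN', le_div_iff₀ hN']
      constructor <;> nlinarith
  have hunion : ⋃ i ∈ Finset.range (N + 1), τ ⁻¹' W i = univ := by
    refine eq_univ_of_forall fun ω => ?_
    simp only [mem_iUnion, Finset.mem_range]
    refine ⟨⌊(N : ℝ) * τ ω⌋₊, ?_, rfl⟩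
    rw [Nat.lt_succ_iff]
    refine Nat.floor_le_of_le ?_
    exact mul_le_of_le_one_right hN'.le (τ ω).2.2
  have hgint : Integrable (fun ω => h * |(X ω - f (τ ω)) j| - B) P :=
    ((integrable_residual_apply hX2 hτm j).abs.const_mul h).sub (integrable_const B)
  have hsum := integral_biUnion_finset (μ := P) (f := fun ω => h * |(X ω - f (τ ω)) j| - B)
    (Finset.range (N + 1)) (s := fun i => τ ⁻¹' W i) (fun i _ => hτm (hWm i))
    (fun i _ k _ hik => disjoint_left.2 fun ω h1 h2 => hik (h1.symm.trans h2))
    (fun i _ => hgint.integrableOn)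
  rw [hunion, setIntegral_univ] at hsum
  have hle := Finset.sum_le_sum hwin
  rw [← hsum, Finset.sum_const, Finset.card_range, nsmul_eq_mul, integral_sub
    ((integrable_residual_apply hX2 hτm j).abs.const_mul h) (integrable_const B),
    integral_const_mul, integral_const] at hle
  simp only [probReal_univ, smul_eq_mul, one_mul] at hle
  push_cast at hle
  linarith

theorem exists_integral_abs_pos (hX2 : MemLp X 2 P) (hτ : IsNearest P X f τ)
    (hpos : 0 < criterion P X f) : ∃ j, 0 < ∫ ω, |(X ω - f (τ ω)) j| ∂P := by
  by_contra! hcon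
  have hzero : ∀ j, ∀ᵐ ω ∂P, (X ω - f (τ ω)) j = 0 := by
    intro j
    have h1 := (integral_eq_zero_iff_of_nonneg (fun ω => abs_nonneg _)
      (integrable_residual_apply hX2 hτ.measurable j).abs).1
      (le_antisymm (hcon j) (integral_nonneg fun ω => abs_nonneg _))
    filter_upwards [h1] with ω hω using abs_eq_zero.1 hω
  have hall : ∀ᵐ ω ∂P, X ω - f (τ ω) = 0 := by
    filter_upwards [ae_all_iff.2 hzero] with ω hω
    ext j
    exact hω j
  rw [criterion_eq hτ, integral_eq_zero_of_ae] at hpos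
  · exact lt_irrefl _ hpos
  · filter_upwards [hall] with ω hω
    simp [hω]

/-- An optimal curve with positive criterion has maximal length. -/
theorem length_eq_of_isOptimal (hX2 : MemLp X 2 P) (hτ : IsNearest P X f τ)
    (hτ1 : κ = CurveKind.closedCurves → ∀ ω, τ ω ≠ 1) (hf : IsOptimal P X κ L f)
    (hpos : 0 < criterion P X f) : length f = ENNReal.ofReal L := by
  by_contra hne
  have hlen : length f < ENNReal.ofReal L := lt_of_le_of_ne hf.mem.1 hne
  obtain ⟨ℓ, hℓ0, hℓ⟩ : ∃ ℓ, 0 ≤ ℓ ∧ length f = ENNReal.ofReal ℓ :=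
    ⟨(length f).toReal, ENNReal.toReal_nonneg, (ENNReal.ofReal_toReal hlen.ne_top).symm⟩
  have hℓL : ℓ < L := by
    rw [hℓ] at hlen
    exact (ENNReal.ofReal_lt_ofReal_iff_of_nonneg hℓ0).1 hlen
  have hnull : ∀ g : I → E d, Measurable g → (∃ C : ℝ, ∀ t, ‖g t‖ ≤ C) →
      ∫ ω, ⟪X ω - f (τ ω), g (τ ω)⟫ ∂P = 0 := fun g hg ⟨C, hC⟩ =>
    integral_inner_eq_zero hX2 hτ.measurable (integral_residual_eq_zero hX2 hτ hf) hτ1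
      (kinkMoment_eq_zero_of_length_lt hX2 hτ hf hlen) hg hC
  obtain ⟨j, hj⟩ := exists_integral_abs_pos hX2 hτ hpos
  set m := ∫ ω, |(X ω - f (τ ω)) j| ∂P with hm
  -- The spare length pays for the spike without contraction (`ε = 0`). With `η = h` the window
  -- bound becomes `h m ≤ (2h)² ≤ h m / 2`.
  set h := min ((L - ℓ) / 2) (m / 8) with hh
  have hh0 : 0 < h := lt_min (by linarith) (by linarith)
  have hh1 : h ≤ (L - ℓ) / 2 := min_le_left _ _
  have hh2 : h ≤ m / 8 := min_le_right _ _
  obtain ⟨δ, hδ, hδf⟩ := Metric.uniformContinuous_iff.1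
    (CompactSpace.uniformContinuous_of_continuous f.continuous) h hh0
  obtain ⟨N, hN⟩ := exists_nat_one_div_lt hδ
  have key := spike_bound_windows hX2 hτ hf hnull hℓ0 hℓ.le le_rfl zero_le_one hh0 hh0.le
    (by linarith) j (Nat.succ_pos N) (fun s t hst => by
      rw [← dist_eq_norm]
      refine (hδf ?_).le
      rw [Subtype.dist_eq, Real.dist_eq]
      push_cast at hst
      exact hst.trans_lt hN)
  rw [← hm] at key
  nlinarith

/-- The Lagrange multiplier of an optimal Lipschitz curve with positive criterion is positive. -/
theorem multiplier_ne_zero (hX2 : MemLp X 2 P) (hτ : IsNearest P X f τ)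
    (hτ1 : κ = CurveKind.closedCurves → ∀ ω, τ ω ≠ 1) (hf : IsOptimal P X κ L f) (hL : 0 < L)
    (hlip : LipschitzWith L.toNNReal f) (hpos : 0 < criterion P X f)
    (h0 : ∀ s : I, kinkMoment P X f κ τ s = 0) : False := by
  have hnull : ∀ g : I → E d, Measurable g → (∃ C : ℝ, ∀ t, ‖g t‖ ≤ C) →
      ∫ ω, ⟪X ω - f (τ ω), g (τ ω)⟫ ∂P = 0 := fun g hg ⟨C, hC⟩ =>
    integral_inner_eq_zero hX2 hτ.measurable (integral_residual_eq_zero hX2 hτ hf) hτ1 h0 hg hC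
  obtain ⟨j, hj⟩ := exists_integral_abs_pos hX2 hτ hpos
  set m := ∫ ω, |(X ω - f (τ ω)) j| ∂P with hm
  set M := ‖f‖ with hM
  have hM0 : 0 ≤ M := norm_nonneg _
  -- Scales: `h = b / N²`, `ε = 2h / L` so that contraction pays exactly for the spike, and `η = L /
  -- N` from the Lipschitz bound. This `b` makes `(2η)² = h m / 4`. The other errors are `O(N⁻³)`,
  -- below `h m / 4` each for large `N`, so `h m < 3 h m / 4`.
  set b := 16 * L ^ 2 / m with hb
  have hb0 : 0 < b := by positivity
  have hbm : b * m = 16 * L ^ 2 := by rw [hb]; field_simp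
  obtain ⟨N, hN⟩ := exists_nat_gt (b / L + 2 * b / L + 32 * M / m + 32 * b * M ^ 2 / (L ^ 2 * m) + 1)
  have q1 : 0 ≤ b / L := by positivity
  have q2 : 0 ≤ 2 * b / L := by positivity
  have q3 : 0 ≤ 32 * M / m := by positivity
  have q4 : 0 ≤ 32 * b * M ^ 2 / (L ^ 2 * m) := by positivity
  have hN1 : (1 : ℝ) < N := by linarith
  have hN0 : (0 : ℝ) < N := by linarith
  have hNb : b < N * L := by rw [← div_lt_iff₀ hL]; linarith
  have hNb2 : 2 * b < N * L := by rw [← div_lt_iff₀ hL]; linarith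
  have hNM : 32 * M < N * m := by rw [← div_lt_iff₀ hj]; linarith
  have hNB : 32 * b * M ^ 2 < N * (L ^ 2 * m) := by rw [← div_lt_iff₀ (by positivity)]; linarith
  set h := b / N ^ 2 with hh
  have hhN : h * N ^ 2 = b := by rw [hh]; field_simp
  have hh0 : 0 < h := by positivity
  set ε := 2 * h / L with hε
  have hεL : ε * L = 2 * h := by rw [hε]; field_simp
  have hε0 : 0 ≤ ε := by positivity
  have hε1 : ε ≤ 1 := by
    rw [hε, div_le_one hL, hh, mul_div_assoc', div_le_iff₀ (by positivity)]
    nlinarith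
  set η := L / N with hη
  have hηN : η * N = L := by rw [hη]; field_simp
  have hη0 : 0 < η := by positivity
  have hhη : h ≤ η := by
    rw [hh, hη, div_le_div_iff₀ (by positivity) hN0]
    nlinarith
  have key := spike_bound_windows hX2 hτ hf hnull hL.le hf.mem.1 hε0 hε1 hh0 hη0.le
    (by nlinarith) j (N := N) (by exact_mod_cast hN0) (fun s t hst => by
      have h1 := hlip.dist_le_mul s t
      rw [dist_eq_norm, Real.coe_toNNReal _ hL.le, Subtype.dist_eq, Real.dist_eq] at h1
      refine h1.trans ((mul_le_mul_of_nonneg_left hst hL.le).trans (le_of_eq ?_))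
      rw [hη]; ring)
  rw [← hm, ← hM] at key
  have k1 : (η + h) ^ 2 ≤ h * m / 4 := by
    have e1 : (η + h) ^ 2 ≤ (2 * η) ^ 2 := by gcongr; linarith
    have e2 : (2 * η) ^ 2 = h * m / 4 := by
      have : h * m * N ^ 2 = 16 * (η * N) ^ 2 := by
        rw [hηN, ← hbm, ← hhN]; ring
      have e3 : (h * m - 16 * η ^ 2) * N ^ 2 = 0 := by linear_combination this
      rcases mul_eq_zero.1 e3 with e4 | e4
      · linear_combination -e4 / 4
      · exact absurd e4 (by positivity)
    exact e1.trans e2.le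
  have k2 : 2 * ε * M * (η + h) ≤ h * m / 4 := by
    have e1 : 2 * ε * M * (η + h) ≤ 2 * ε * M * (2 * η) := by gcongr; linarith
    have e2 : 2 * ε * M * (2 * η) * N = 8 * h * M := by
      calc 2 * ε * M * (2 * η) * N = 4 * ε * M * (η * N) := by ring
        _ = 4 * M * (ε * L) := by rw [hηN]; ring
        _ = 8 * h * M := by rw [hεL]; ring
    have e3 : 8 * h * M ≤ h * m / 4 * N := by
      have := mul_le_mul_of_nonneg_left hNM.le (by positivity : 0 ≤ h / 4)
      linarith
    rw [← e2] at e3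
    exact e1.trans (le_of_mul_le_mul_right e3 hN0)
  have k3 : (N + 1) * (ε ^ 2 * M ^ 2) < h * m / 4 := by
    have e1 : (N + 1) * (ε ^ 2 * M ^ 2) ≤ 2 * N * (ε ^ 2 * M ^ 2) := by gcongr; linarith
    have e2 : 2 * N * (ε ^ 2 * M ^ 2) * (L ^ 2 * N) = 8 * h * b * M ^ 2 := by
      calc 2 * N * (ε ^ 2 * M ^ 2) * (L ^ 2 * N) = 2 * (ε * L) ^ 2 * M ^ 2 * N ^ 2 := by ring
        _ = 8 * h * (h * N ^ 2) * M ^ 2 := by rw [hεL]; ring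
        _ = 8 * h * b * M ^ 2 := by rw [hhN]
    have e3 : 8 * h * b * M ^ 2 < h * m / 4 * (L ^ 2 * N) := by
      have := mul_lt_mul_of_pos_left hNB (by positivity : 0 < h / 4)
      linarith
    rw [← e2] at e3
    exact e1.trans_lt (lt_of_mul_lt_mul_right e3 (by positivity))
  have := mul_pos hh0 hj
  linarith

end PrincipalCurve

/-! ### One-sided derivatives and constant speed -/

namespace PrincipalCurve

variable {Ω : Type*} [MeasurableSpace Ω] {P : Measure Ω} [IsProbabilityMeasure P] {d : ℕ}
  {X : Ω → E d} {f : C(I, E d)} {τ : Ω → I} {κ : CurveKind} {L : ℝ}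

theorem hasDerivWithinAt_extend_right (hX2 : MemLp X 2 P) (hτ : Measurable τ) {lam : ℝ}
    (hlam : 0 < lam) (h : ∀ s : I, kinkMoment P X f κ τ s = lam • (f s - f 0)) {t : I} (ht : t < 1) :
    HasDerivWithinAt (extend f)
      (lam⁻¹ • (residualMass P X f τ (Ioi t) - momentDrift P X f κ τ)) (Ioi (t : ℝ)) t := by
  have h1 := ((hasDerivWithinAt_smul_extend_right hX2 hτ h ht).const_smul lam⁻¹).add_const (f 0)
  refine h1.congr (fun s _ => ?_) ?_ <;> simp [smul_smul, inv_mul_cancel₀ hlam.ne']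

theorem hasDerivWithinAt_extend_left (hX2 : MemLp X 2 P) (hτ : Measurable τ) {lam : ℝ}
    (hlam : 0 < lam) (h : ∀ s : I, kinkMoment P X f κ τ s = lam • (f s - f 0)) {t : I} (ht : 0 < t) :
    HasDerivWithinAt (extend f)
      (lam⁻¹ • (residualMass P X f τ (Ici t) - momentDrift P X f κ τ)) (Iio (t : ℝ)) t := by
  have h1 := ((hasDerivWithinAt_smul_extend_left hX2 hτ h ht).const_smul lam⁻¹).add_const (f 0)
  refine h1.congr (fun s _ => ?_) ?_ <;> simp [smul_smul, inv_mul_cancel₀ hlam.ne']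

theorem rightDeriv_eq (hX2 : MemLp X 2 P) (hτ : Measurable τ) {lam : ℝ}
    (hlam : 0 < lam) (h : ∀ s : I, kinkMoment P X f κ τ s = lam • (f s - f 0)) {t : I} (ht : t < 1) :
    rightDeriv f t = lam⁻¹ • (residualMass P X f τ (Ioi t) - momentDrift P X f κ τ) :=
  (hasDerivWithinAt_extend_right hX2 hτ hlam h ht).derivWithin (uniqueDiffWithinAt_Ioi _)

theorem leftDeriv_eq (hX2 : MemLp X 2 P) (hτ : Measurable τ) {lam : ℝ}
    (hlam : 0 < lam) (h : ∀ s : I, kinkMoment P X f κ τ s = lam • (f s - f 0)) {t : I} (ht : 0 < t) :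
    leftDeriv f t = lam⁻¹ • (residualMass P X f τ (Ici t) - momentDrift P X f κ τ) :=
  (hasDerivWithinAt_extend_left hX2 hτ hlam h ht).derivWithin (uniqueDiffWithinAt_Iio _)

theorem continuous_extend (f : C(I, E d)) : Continuous (extend f) :=
  f.continuous.Icc_extend'

theorem lipschitzWith_extend {K : NNReal} (hlip : LipschitzWith K f) :
    LipschitzWith K (extend f) := by
  have := hlip.comp (LipschitzWith.projIcc (zero_le_one : (0 : ℝ) ≤ 1))
  rwa [mul_one] at this

theorem norm_rightDeriv_le (hL : 0 < L) (hlip : LipschitzWith L.toNNReal f) {t : I}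
    (ht : RightDifferentiableAt f t) : ‖rightDeriv f t‖ ≤ L := by
  have h1 := hasDerivWithinAt_iff_tendsto_slope' self_notMem_Ioi |>.1 ht.hasDerivWithinAt
  refine le_of_tendsto h1.norm (Filter.Eventually.of_forall fun s => ?_)
  have h2 := (lipschitzWith_extend hlip).dist_le_mul s t
  rw [dist_eq_norm, Real.coe_toNNReal _ hL.le, Real.dist_eq] at h2
  rw [slope_def_module, norm_smul, norm_inv, Real.norm_eq_abs]
  rcases eq_or_ne s t with rfl | hne
  · simp [hL.le]
  · rw [inv_mul_le_iff₀ (abs_pos.2 (sub_ne_zero.2 hne)), mul_comm]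
    exact h2

/-- A Lipschitz curve which is slower on a subinterval is shorter. -/
theorem length_lt_of_slow (hL : 0 < L) (hlip : LipschitzWith L.toNNReal f) {a b : I} (hab : a < b)
    {c : ℝ} (hcL : c < L)
    (hc : ∀ s t : I, a ≤ s → s ≤ t → t ≤ b → ‖f t - f s‖ ≤ c * ((t : ℝ) - s)) :
    length f < ENNReal.ofReal L := by
  -- The clamped parameter moves only on `[a, b]`, so `H` has slope `c` there and slope `L`
  -- elsewhere.
  set H : I → ℝ := fun t => L * t - (L - c) * (max (a : ℝ) (min t b)) with hH
  have hLip : ∀ s t : I, s ≤ t → ‖f t - f s‖ ≤ L * ((t : ℝ) - s) := fun s t hst => by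
    have := hlip.dist_le_mul t s
    rwa [dist_eq_norm, Real.coe_toNNReal _ hL.le, Subtype.dist_eq, Real.dist_eq,
      abs_of_nonneg (sub_nonneg.2 (Subtype.coe_le_coe.2 hst))] at this
  have hab' : (a : ℝ) < b := hab
  have htrans : ∀ r s t : I, r ≤ s → s ≤ t → ‖f s - f r‖ ≤ H s - H r → ‖f t - f s‖ ≤ H t - H s →
      ‖f t - f r‖ ≤ H t - H r := by
    intro r s t _ _ h1 h2
    refine (norm_sub_le_norm_sub_add_norm_sub _ (f s) _).trans ?_
    linarith
  have hall : ∀ s t : I, s ≤ t → ‖f t - f s‖ ≤ H t - H s := by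
    intro s t hst
    refine rel_of_not_crossing (R := fun s t => ‖f t - f s‖ ≤ H t - H s) htrans a hst ?_
    intro s' t' _ hst' _ h1
    refine rel_of_not_crossing (R := fun s t => ‖f t - f s‖ ≤ H t - H s) htrans b hst' ?_
    intro r u hr hru hu h2
    have h3 : u ≤ a ∨ a ≤ r := h1.imp hu.trans fun h => h.trans hr
    have hru' : (r : ℝ) ≤ u := hru
    rcases h3 with h3 | h3
    · have h3' : (u : ℝ) ≤ a := h3
      have e1 : max (a : ℝ) (min (u : ℝ) b) = a := max_eq_left ((min_le_left _ _).trans h3')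
      have e2 : max (a : ℝ) (min (r : ℝ) b) = a :=
        max_eq_left ((min_le_left _ _).trans (hru'.trans h3'))
      simp only [hH, e1, e2]
      linarith [hLip r u hru]
    · have h3' : (a : ℝ) ≤ r := h3
      rcases h2 with h2 | h2
      · have h2' : (u : ℝ) ≤ b := h2
        have e1 : max (a : ℝ) (min (u : ℝ) b) = u := by
          rw [min_eq_left h2', max_eq_right (h3'.trans hru')]
        have e2 : max (a : ℝ) (min (r : ℝ) b) = r := by
          rw [min_eq_left (hru'.trans h2'), max_eq_right h3']
        simp only [hH, e1, e2]
        linarith [hc r u h3 hru h2]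
      · have h2' : (b : ℝ) ≤ r := h2
        have e1 : max (a : ℝ) (min (u : ℝ) b) = b := by
          rw [min_eq_right (h2'.trans hru'), max_eq_right hab'.le]
        have e2 : max (a : ℝ) (min (r : ℝ) b) = b := by
          rw [min_eq_right h2', max_eq_right hab'.le]
        simp only [hH, e1, e2]
        linarith [hLip r u hru]
  refine (eVariationOn_le_of_dominated f H hall).trans_lt ((ENNReal.ofReal_lt_ofReal_iff hL).2 ?_)
  have e1 : max (a : ℝ) (min (1 : ℝ) b) = b := by
    rw [min_eq_right b.2.2, max_eq_right hab'.le]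
  have e0 : max (a : ℝ) (min (0 : ℝ) b) = a := by
    rw [min_eq_left b.2.1, max_eq_left a.2.1]
  simp only [hH, Set.Icc.coe_one, Set.Icc.coe_zero, e1, e0]
  nlinarith

/-- A speed below `L` at one point persists on an interval to its right, by right continuity of the
right derivative. The mean value inequality makes the curve slow there, contradicting its length. -/
theorem norm_rightDeriv_eq (hX2 : MemLp X 2 P) (hτ : Measurable τ) (hL : 0 < L)
    (hlip : LipschitzWith L.toNNReal f) (hlen : length f = ENNReal.ofReal L) {lam : ℝ}
    (hlam : 0 < lam) (h : ∀ s : I, kinkMoment P X f κ τ s = lam • (f s - f 0)) {t : I}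
    (ht : t < 1) : ‖rightDeriv f t‖ = L := by
  have hdiff : ∀ {t : I}, t < 1 → RightDifferentiableAt f t := fun ht =>
    (hasDerivWithinAt_extend_right hX2 hτ hlam h ht).differentiableWithinAt
  refine le_antisymm (norm_rightDeriv_le hL hlip (hdiff ht)) ?_
  by_contra! hlt
  obtain ⟨c, hc1, hc2⟩ := exists_between hlt
  have hlim := (((tendsto_residualMass_right (f := f) hX2 hτ t).sub_const
    (momentDrift P X f κ τ)).const_smul lam⁻¹).norm
  rw [← rightDeriv_eq hX2 hτ hlam h ht] at hlim
  obtain ⟨b, hb, hbs⟩ := (mem_nhdsGT_iff_exists_Ioo_subset' ht).1 (hlim.eventually_lt_const hc1)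
  obtain ⟨b', hb', hbb'⟩ := exists_between (show t < b from hb)
  have hbound : ∀ s : I, t ≤ s → s < b' → ‖rightDeriv f s‖ ≤ c := by
    intro s hs hsb
    rcases hs.eq_or_lt with rfl | hs
    · exact hc1.le
    · rw [rightDeriv_eq hX2 hτ hlam h (hsb.trans_le unitInterval.le_one')]
      exact (hbs ⟨hs, hsb.trans hbb'⟩ : _ < c).le
  refine absurd hlen (length_lt_of_slow hL hlip hb' hc2 fun r u hr hru hu => ?_).ne
  have hmem : ∀ x ∈ Ico (r : ℝ) u, x ∈ Icc (0 : ℝ) 1 := fun x hx =>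
    ⟨r.2.1.trans hx.1, hx.2.le.trans u.2.2⟩
  have key := norm_image_sub_le_of_norm_deriv_right_le_segment (f := extend f) (a := r) (b := u)
    (f' := fun x => derivWithin (extend f) (Ioi x) x) (C := c)
    (continuous_extend f).continuousOn (fun x hx => by
      have hx1 : (⟨x, hmem x hx⟩ : I) < 1 := Subtype.coe_lt_coe.1 (hx.2.trans_le u.2.2)
      exact (hdiff hx1).hasDerivWithinAt.Ici_of_Ioi) (fun x hx =>
      hbound ⟨x, hmem x hx⟩ (Subtype.coe_le_coe.1 ((Subtype.coe_le_coe.2 hr).trans hx.1))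
        (Subtype.coe_lt_coe.1 (hx.2.trans_le (Subtype.coe_le_coe.2 hu))))
    u ⟨hru, le_rfl⟩
  rwa [extend_coe, extend_coe] at key

/-- The left derivative is the limit from the left of right derivatives, all of norm `L`. -/
theorem norm_leftDeriv_eq (hX2 : MemLp X 2 P) (hτ : Measurable τ) (hL : 0 < L)
    (hlip : LipschitzWith L.toNNReal f) (hlen : length f = ENNReal.ofReal L) {lam : ℝ}
    (hlam : 0 < lam) (h : ∀ s : I, kinkMoment P X f κ τ s = lam • (f s - f 0)) {t : I}
    (ht : 0 < t) : ‖leftDeriv f t‖ = L := by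
  have hlim := (((tendsto_residualMass_left (f := f) hX2 hτ t).sub_const
    (momentDrift P X f κ τ)).const_smul lam⁻¹).norm
  rw [← leftDeriv_eq hX2 hτ hlam h ht] at hlim
  have : (nhdsWithin t (Iio t)).NeBot := nhdsLT_neBot_of_exists_lt ⟨0, ht⟩
  refine tendsto_nhds_unique (hlim.congr' ?_) tendsto_const_nhds
  filter_upwards [self_mem_nhdsWithin] with s hs
  have hs1 : s < 1 := lt_of_lt_of_le hs unitInterval.le_one'
  rw [← rightDeriv_eq hX2 hτ hlam h hs1, norm_rightDeriv_eq hX2 hτ hL hlip hlen hlam h hs1]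

end PrincipalCurve

/-! ### The second derivative as a measure -/

namespace PrincipalCurve

variable {Ω : Type*} [MeasurableSpace Ω] {P : Measure Ω} [IsProbabilityMeasure P] {d : ℕ}
  {X : Ω → E d} {f : C(I, E d)} {τ : Ω → I} {κ : CurveKind} {L : ℝ}

namespace VecSignedMeasure

variable {ν ν' : VecSignedMeasure d}

theorem value_eq_iff {A B : Set I} : ν.value A = ν'.value B ↔ ∀ j, ν j A = ν' j B := by
  simp only [value, PiLp.ext_iff]

theorem value_union {A B : Set I} (h : Disjoint A B) (hA : MeasurableSet A)
    (hB : MeasurableSet B) : ν.value (A ∪ B) = ν.value A + ν.value B := by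
  ext j
  exact VectorMeasure.of_union h hA hB

theorem value_compl {A : Set I} (hA : MeasurableSet A) :
    ν.value Aᶜ = ν.value univ - ν.value A := by
  rw [eq_sub_iff_add_eq', ← value_union disjoint_compl_right hA hA.compl, union_compl_self]

end VecSignedMeasure

open VecSignedMeasure

/-- The right derivative is `lam⁻¹` times the mass of `(t,1]`, up to a constant drift that cancels
in increments. The drift vanishes for open curves, which gives the endpoint atoms; the total mass is
the mean residual. -/
theorem isSecondDerivative_residualMeasure (hX2 : MemLp X 2 P) (hτ : Measurable τ)
    (hmean : ∫ ω, (X ω - f (τ ω)) ∂P = 0) {lam : ℝ} (hlam : 0 < lam)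
    (h : ∀ s : I, kinkMoment P X f κ τ s = lam • (f s - f 0)) :
    IsSecondDerivative κ f (residualMeasure P X f τ (-lam⁻¹)) where
  increment s t hst ht := by
    rw [value_residualMeasure hX2 hτ _ measurableSet_Ioc, rightDeriv_eq hX2 hτ hlam h ht,
      rightDeriv_eq hX2 hτ hlam h (hst.trans_lt ht), ← smul_sub, sub_sub_sub_cancel_right,
      ← Ioc_union_Ioi_eq_Ioi hst, residualMass_union hX2 hτ _ measurableSet_Ioi, sub_add_cancel_right,
      neg_smul, smul_neg]
    exact disjoint_left.2 fun x h1 h2 => not_lt_of_ge h1.2 h2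
  total := by
    rw [value_residualMeasure hX2 hτ _ .univ, residualMass_univ, hmean, smul_zero]
  atom_zero hκ := by
    subst hκ
    have h1 : residualMass P X f τ univ = residualMass P X f τ {0} + residualMass P X f τ (Ioi 0) := by
      rw [← residualMass_union hX2 hτ (by simp) measurableSet_Ioi]
      congr 1
      ext t
      simp
    rw [residualMass_univ, hmean] at h1
    rw [value_residualMeasure hX2 hτ _ (measurableSet_singleton _),
      rightDeriv_eq hX2 hτ hlam h zero_lt_one, eq_neg_of_add_eq_zero_left h1.symm]
    simp [momentDrift, closedWeight]
  atom_one hκ := by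
    subst hκ
    have h1 : (Ici 1 : Set I) = {1} := by
      ext t
      simpa using ⟨fun h => le_antisymm unitInterval.le_one' h, fun h => h.ge⟩
    rw [value_residualMeasure hX2 hτ _ (measurableSet_singleton _),
      leftDeriv_eq hX2 hτ hlam h zero_lt_one, h1]
    simp [momentDrift, closedWeight]

omit [IsProbabilityMeasure P] in
theorem residualMass_one_eq_zero (hτ1 : ∀ ω, τ ω ≠ 1) : residualMass P X f τ {1} = 0 := by
  have : τ ⁻¹' {1} = ∅ := by ext ω; simp [hτ1 ω]
  rw [residualMass, this, setIntegral_empty]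

/-- Two second derivatives agree on intervals `(t, 1)`. -/
theorem IsSecondDerivative.value_Ioo {ν ν' : VecSignedMeasure d} (hν : IsSecondDerivative κ f ν)
    (hν' : IsSecondDerivative κ f ν') (t : I) (j : Fin d) : ν j (Ioo t 1) = ν' j (Ioo t 1) := by
  rcases eq_or_lt_of_le (unitInterval.le_one' : t ≤ 1) with rfl | ht
  · simp
  -- Increments are prescribed only up to parameters below `1`, so the open interval is exhausted by
  -- half-open ones.
  obtain ⟨u, hmono, hmem, hlim⟩ := exists_seq_strictMono_tendsto' ht
  have hU : ⋃ n, Ioc t (u n) = Ioo t 1 := by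
    ext x
    simp only [mem_iUnion, mem_Ioc, mem_Ioo]
    constructor
    · rintro ⟨n, h1, h2⟩
      exact ⟨h1, h2.trans_lt (hmem n).2⟩
    · rintro ⟨h1, h2⟩
      obtain ⟨n, hn⟩ := (hlim.eventually_const_lt h2).exists
      exact ⟨n, h1, hn.le⟩
  have hm : Monotone fun n => Ioc t (u n) := fun m n hmn =>
    Ioc_subset_Ioc_right (hmono.monotone hmn)
  have h1 := VectorMeasure.tendsto_vectorMeasure_iUnion_atTop_nat (v := ν j) hm
    fun n => measurableSet_Ioc
  have h2 := VectorMeasure.tendsto_vectorMeasure_iUnion_atTop_nat (v := ν' j) hm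
    fun n => measurableSet_Ioc
  rw [hU] at h1 h2
  refine tendsto_nhds_unique h1 (h2.congr fun n => ?_)
  have h3 : ν.value (Ioc t (u n)) = ν'.value (Ioc t (u n)) := by
    rw [hν.increment t (u n) (hmem n).1.le (hmem n).2, hν'.increment t (u n) (hmem n).1.le (hmem n).2]
  exact (value_eq_iff.1 h3 j).symm

/-- Two second derivatives agree on subsets of `(0, 1)`. -/
theorem IsSecondDerivative.apply_eq_of_subset {ν ν' : VecSignedMeasure d}
    (hν : IsSecondDerivative κ f ν) (hν' : IsSecondDerivative κ f ν') {A : Set I}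
    (hA : MeasurableSet A) (hA1 : A ⊆ Ioo 0 1) (j : Fin d) : ν j A = ν' j A := by
  have h : (ν j).restrict (Ioo 0 1) = (ν' j).restrict (Ioo 0 1) := by
    refine signedMeasure_ext_Ioi ?_ fun t => ?_
    · rw [VectorMeasure.restrict_apply _ measurableSet_Ioo .univ,
        VectorMeasure.restrict_apply _ measurableSet_Ioo .univ, univ_inter]
      exact hν.value_Ioo hν' 0 j
    · rw [VectorMeasure.restrict_apply _ measurableSet_Ioo measurableSet_Ioi,
        VectorMeasure.restrict_apply _ measurableSet_Ioo measurableSet_Ioi]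
      have : Ioi t ∩ Ioo 0 1 = Ioo t 1 := by
        ext x
        simp only [mem_inter_iff, mem_Ioi, mem_Ioo]
        exact ⟨fun h => ⟨h.1, h.2.2⟩, fun h => ⟨h.1, unitInterval.nonneg'.trans_lt h.1, h.2⟩⟩
      rw [this]
      exact hν.value_Ioo hν' t j
  have h1 := congrArg (fun μ : SignedMeasure I => μ A) h
  simp only [VectorMeasure.restrict_apply _ measurableSet_Ioo hA, inter_eq_left.2 hA1] at h1
  exact h1

/-- Increments fix the measure on `(0,1)`; once the atom at `1` is known, the total mass determines
the one at `0`. -/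
theorem IsSecondDerivative.eq {ν ν' : VecSignedMeasure d} (hν : IsSecondDerivative κ f ν)
    (hν' : IsSecondDerivative κ f ν') (h1 : ν.value {1} = ν'.value {1}) : ν = ν' := by
  funext j
  refine signedMeasure_ext_Ioi (value_eq_iff.1 (hν.total.trans hν'.total.symm) j) fun t => ?_
  rcases eq_or_lt_of_le (unitInterval.le_one' : t ≤ 1) with rfl | ht
  · simp [Ioi_one_eq_empty]
  have : Ioi t = Ioo t 1 ∪ {1} := by
    ext x
    simp only [mem_Ioi, mem_union, mem_Ioo, mem_singleton_iff]
    constructor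
    · intro hx
      rcases eq_or_lt_of_le (unitInterval.le_one' : x ≤ 1) with h | h
      · exact Or.inr h
      · exact Or.inl ⟨hx, h⟩
    · rintro (h | rfl)
      · exact h.1
      · exact ht
  have hd : Disjoint (Ioo t 1) {1} := by simp
  rw [this, VectorMeasure.of_union hd measurableSet_Ioo (measurableSet_singleton _),
    VectorMeasure.of_union hd measurableSet_Ioo (measurableSet_singleton _), hν.value_Ioo hν' t j,
    value_eq_iff.1 h1 j]

/-- Uniqueness of the second derivative. -/
theorem IsSecondDerivative.sameMeasure {ν ν' : VecSignedMeasure d} (hν : IsSecondDerivative κ f ν)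
    (hν' : IsSecondDerivative κ f ν') : SameMeasure κ ν ν' := by
  cases κ with
  | openCurves => exact hν.eq hν' ((hν.atom_one rfl).trans (hν'.atom_one rfl).symm)
  | closedCurves =>
    intro A hA h01
    have key : ∀ A : Set I, MeasurableSet A → (0 : I) ∉ A → (1 : I) ∉ A →
        ν.value A = ν'.value A := by
      intro A hA h0 h1
      refine value_eq_iff.2 fun j => hν.apply_eq_of_subset hν' hA (fun x hx => ⟨?_, ?_⟩) j
      · exact lt_of_le_of_ne unitInterval.nonneg' fun h => h0 (h ▸ hx)
      · exact lt_of_le_of_ne unitInterval.le_one' fun h => h1 (h ▸ hx)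
    -- A set containing both endpoints is replaced by its complement, which is legitimate because
    -- both total masses vanish.
    by_cases h0 : (0 : I) ∈ A
    · have h1 := key Aᶜ hA.compl (fun h => h h0) (fun h => h (h01.1 h0))
      rw [value_compl hA, value_compl hA, hν.total, hν'.total] at h1
      simpa using h1
    · exact key A hA h0 fun h => h0 (h01.2 h)

/-- The multiplier relation: every choice of nearest parameters has residual measure proportional to
the second derivative. -/
theorem exists_pos_multiplier (hX2 : MemLp X 2 P) (hτ : IsNearest P X f τ)
    (hτ1 : κ = CurveKind.closedCurves → ∀ ω, τ ω ≠ 1) (hf : IsOptimal P X κ L f) (hL : 0 < L)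
    (hlip : LipschitzWith L.toNNReal f) (hpos : 0 < criterion P X f) :
    ∃ lam : ℝ, 0 < lam ∧ ∀ s : I, kinkMoment P X f κ τ s = lam • (f s - f 0) := by
  obtain ⟨lam, h0, h⟩ := exists_multiplier hX2 hτ hf hL hlip
    (length_eq_of_isOptimal hX2 hτ hτ1 hf hpos)
  refine ⟨lam, lt_of_le_of_ne h0 ?_, h⟩
  rintro rfl
  exact multiplier_ne_zero hX2 hτ hτ1 hf hL hlip hpos fun s => by rw [h s, zero_smul]

/-- Here `ν` is fixed before `τ`: uniqueness of the second derivative puts the residual measures of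
all nearest choices on one ray. In the closed case both sides are normalized to have no atom at `1`.
-/
theorem exists_residualMass_eq (hX2 : MemLp X 2 P) (hτ : IsNearest P X f τ)
    (hτ1 : κ = CurveKind.closedCurves → ∀ ω, τ ω ≠ 1) (hf : IsOptimal P X κ L f) (hL : 0 < L)
    (hlip : LipschitzWith L.toNNReal f) (hpos : 0 < criterion P X f) {ν : VecSignedMeasure d}
    (hν : IsSecondDerivative κ f ν) (hν1 : κ = CurveKind.closedCurves → ν.value {1} = 0) :
    ∃ lam : ℝ, 0 < lam ∧ ∀ A : Set I, MeasurableSet A →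
      residualMass P X f τ A = -lam • ν.value A := by
  obtain ⟨lam, hlam, h⟩ := exists_pos_multiplier hX2 hτ hτ1 hf hL hlip hpos
  refine ⟨lam, hlam, fun A hA => ?_⟩
  have hν' := isSecondDerivative_residualMeasure hX2 hτ.measurable
    (integral_residual_eq_zero hX2 hτ hf) hlam h
  have heq : ν = residualMeasure P X f τ (-lam⁻¹) := by
    refine hν.eq hν' ?_
    cases hκ : κ with
    | openCurves => rw [hν.atom_one hκ, hν'.atom_one hκ]
    | closedCurves =>
      rw [hν1 hκ, value_residualMeasure hX2 hτ.measurable _ (measurableSet_singleton _),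
        residualMass_one_eq_zero (hτ1 hκ), smul_zero]
  rw [heq, value_residualMeasure hX2 hτ.measurable _ hA, smul_smul, neg_mul_neg,
    mul_inv_cancel₀ hlam.ne', one_smul]

end PrincipalCurve

/-! ### Uniqueness of the multiplier on one probability space -/

namespace PrincipalCurve

open VecSignedMeasure

section Line

variable {d : ℕ} {f : C(I, E d)}

/-- A curve whose right derivative is constant is affine; version after applying a linear map. -/
theorem map_sub_eq_smul_of_rightDeriv {F : Type*} [NormedAddCommGroup F] [NormedSpace ℝ F]
    (T : E d →L[ℝ] F) {c : F} (hdiff : ∀ t : I, t < 1 → RightDifferentiableAt f t)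
    (hT : ∀ t : I, t < 1 → T (rightDeriv f t) = c) (t : I) : T (f t - f 0) = (t : ℝ) • c := by
  have hder : ∀ x ∈ Ico (0 : ℝ) 1,
      HasDerivWithinAt (fun s => T (extend f s) - s • c) 0 (Ici x) x := by
    intro x hx
    have hx1 : (⟨x, hx.1, hx.2.le⟩ : I) < 1 := Subtype.coe_lt_coe.1 hx.2
    have h1 := T.hasFDerivAt.comp_hasDerivWithinAt x (hdiff _ hx1).hasDerivWithinAt.Ici_of_Ioi
    have h2 := h1.sub ((hasDerivWithinAt_id x (Ici x)).smul_const c)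
    rw [one_smul] at h2
    have h3 := hT _ hx1
    rw [rightDeriv] at h3
    rwa [h3, sub_self] at h2
  have hcont : ContinuousOn (fun s => T (extend f s) - s • c) (Icc 0 1) :=
    ((T.continuous.comp (continuous_extend f)).sub (continuous_id.smul continuous_const)).continuousOn
  have h := constant_of_has_deriv_right_zero hcont hder t t.2
  have e0 : extend f 0 = f 0 := extend_coe f 0
  simp only [extend_coe, e0, zero_smul, sub_zero] at h
  rw [map_sub, ← h]
  abel

/-- If the right derivative takes at most two values, and only one if the curve is not closed, the
image of the curve lies on a line. -/
theorem exists_line_of_two_values (hdiff : ∀ t : I, t < 1 → RightDifferentiableAt f t)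
    {v w : E d} (hvw : ∀ t : I, t < 1 → rightDeriv f t = v ∨ rightDeriv f t = w)
    (hclosed : f 0 = f 1 ∨ v = w) :
    ∃ (x : I → ℝ) (u : E d), Continuous x ∧ ∀ t, f t = f 0 + x t • u := by
  by_cases heq : v = w
  · subst heq
    refine ⟨fun t => t, v, continuous_subtype_val, fun t => ?_⟩
    have := map_sub_eq_smul_of_rightDeriv (ContinuousLinearMap.id ℝ (E d)) hdiff
      (c := v) (fun t ht => by simpa using hvw t ht) t
    rw [← this]
    simp
  · have hcl : f 0 = f 1 := hclosed.resolve_right heq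
    set u := v - w with hu
    have hu0 : ‖u‖ ^ 2 ≠ 0 := by
      have : u ≠ 0 := sub_ne_zero.2 heq
      positivity
    -- Orthogonal projection along `u = v - w`. It identifies the two derivative values, so the
    -- projected curve is affine, and closedness makes it constant.
    set T : E d →L[ℝ] E d := ContinuousLinearMap.id ℝ (E d) -
      (((‖u‖ ^ 2)⁻¹) • innerSL ℝ u).smulRight u with hT
    have hTa : ∀ z, T z = z - ((‖u‖ ^ 2)⁻¹ * ⟪u, z⟫) • u := fun z => by simp [hT]
    have hTu : T u = 0 := by
      rw [hTa, real_inner_self_eq_norm_sq, inv_mul_cancel₀ hu0, one_smul, sub_self]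
    have hTv : T v = T w := by rw [← sub_eq_zero, ← map_sub, ← hu, hTu]
    have hmain := map_sub_eq_smul_of_rightDeriv T hdiff (c := T w) (fun t ht => by
      rcases hvw t ht with h | h <;> rw [h]
      exact hTv)
    have hw0 : T w = 0 := by
      have := hmain 1
      rw [← hcl, sub_self, map_zero, Icc.coe_one, one_smul] at this
      exact this.symm
    refine ⟨fun t => (‖u‖ ^ 2)⁻¹ * ⟪u, f t - f 0⟫, u, by fun_prop, fun t => ?_⟩
    have := hmain t
    rw [hw0, smul_zero, hTa, sub_eq_zero] at this
    rw [← this]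
    simp

/-- On a curve whose image lies on a line, the nearest point is unique. -/
theorem eq_of_nearest_of_line {x : I → ℝ} {u : E d} (hx : Continuous x)
    (hfx : ∀ t, f t = f 0 + x t • u) {y : E d} {s t : I} (hs : ‖y - f s‖ = ⨅ r : I, ‖y - f r‖)
    (ht : ‖y - f t‖ = ⨅ r : I, ‖y - f r‖) : f s = f t := by
  -- The midpoint of two nearest points is again on the curve, by the intermediate value theorem;
  -- the parallelogram law would make it strictly closer if they differed.
  obtain ⟨r, hr⟩ : (x s + x t) / 2 ∈ range x := by
    refine mem_range_of_exists_le_of_exists_ge hx ?_ ?_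
    · rcases le_total (x s) (x t) with h | h
      · exact ⟨s, by linarith⟩
      · exact ⟨t, by linarith⟩
    · rcases le_total (x s) (x t) with h | h
      · exact ⟨t, by linarith⟩
      · exact ⟨s, by linarith⟩
  have hmid : y - f r = (1 / 2 : ℝ) • ((y - f s) + (y - f t)) := by
    rw [hfx r, hfx s, hfx t, hr]
    module
  have h1 : ‖y - f s‖ ≤ ‖y - f r‖ := hs ▸ ciInf_le (bddBelow_norm_sub y f) r
  have h2 := parallelogram_law_with_norm ℝ (y - f s) (y - f t)
  have h3 : ‖y - f r‖ = 1 / 2 * ‖(y - f s) + (y - f t)‖ := by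
    rw [hmid, norm_smul]; norm_num
  have h4 : ‖(y - f s) - (y - f t)‖ = 0 := by
    have h5 : ‖y - f t‖ = ‖y - f s‖ := ht.trans hs.symm
    rw [h5] at h2
    have h6 := norm_nonneg (y - f s)
    nlinarith [norm_nonneg ((y - f s) - (y - f t))]
  rw [norm_eq_zero, sub_sub_sub_cancel_left, sub_eq_zero] at h4
  exact h4.symm

end Line

variable {Ω : Type*} [MeasurableSpace Ω] {P : Measure Ω} [IsProbabilityMeasure P] {d : ℕ}
  {X : Ω → E d} {f : C(I, E d)} {τ τ' : Ω → I} {κ : CurveKind} {L : ℝ}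

/-- Contracting an optimal curve strictly increases the criterion to first order. -/
theorem integral_inner_self_pos (hX2 : MemLp X 2 P) (hτ : IsNearest P X f τ)
    (hf : IsOptimal P X κ L f) (hL : 0 < L) (hlen : length f = ENNReal.ofReal L) {lam : ℝ}
    (hlam : 0 < lam) (h : ∀ s : I, kinkMoment P X f κ τ s = lam • (f s - f 0)) :
    0 < ∫ ω, ⟪X ω - f (τ ω), f (τ ω)⟫ ∂P := by
  obtain ⟨a, ha⟩ : ∃ a, f a - f 0 ≠ 0 := by
    by_contra! hcon
    have : length f = 0 := eVariationOn.constant_on (by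
      rintro _ ⟨s, _, rfl⟩ _ ⟨t, _, rfl⟩
      rw [sub_eq_zero.1 (hcon s), sub_eq_zero.1 (hcon t)])
    rw [hlen, ENNReal.ofReal_eq_zero] at this
    linarith
  set q := f a - f 0 with hq
  have hq0 : 0 < ‖q‖ := norm_pos_iff.2 ha
  -- Scaled so that the kink has length at most `L`: the convex combination of `f` and the kink is
  -- then admissible, and the kink contributes `lam * ⟪q, v⟫ > 0` to the first variation.
  set v := (L / (2 * ‖q‖)) • q with hv
  have hvn : 2 * ‖v‖ = L := by
    rw [hv, norm_smul, Real.norm_eq_abs, abs_of_pos (by positivity)]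
    field_simp
  have key := integral_inner_nonpos hX2 hτ hf (-f + kinkCurve κ a v) one_pos (fun ε h0 h1 => by
    have e1 : f + ε • (-f + kinkCurve κ a v) = (1 - ε) • f + ε • kinkCurve κ a v := by
      ext1 t
      simp only [ContinuousMap.add_apply, ContinuousMap.smul_apply, ContinuousMap.neg_apply]
      module
    rw [e1]
    refine ⟨?_, fun hκ => ?_⟩
    · refine (length_add_le _ _).trans ((add_le_add ((length_smul_le _ _).trans
        (mul_le_mul_right hlen.le _)) ((length_smul_le _ _).trans
        (mul_le_mul_right (length_kinkCurve_le κ a v) _))).trans ?_)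
      rw [abs_of_pos h0, abs_of_pos (by linarith), hvn, ← ENNReal.ofReal_mul (by linarith),
        ← ENNReal.ofReal_mul h0.le, ← ENNReal.ofReal_add (mul_nonneg (by linarith) hL.le)
        (by positivity)]
      exact ENNReal.ofReal_le_ofReal (by linarith)
    · subst hκ
      rw [ContinuousMap.add_apply, ContinuousMap.add_apply]
      simp only [ContinuousMap.smul_apply, kinkCurve_endpoints, hf.mem.2 rfl])
  have hsplit : ∫ ω, ⟪X ω - f (τ ω), (-f + kinkCurve κ a v) (τ ω)⟫ ∂P =
      -∫ ω, ⟪X ω - f (τ ω), f (τ ω)⟫ ∂P + ⟪kinkMoment P X f κ τ a, v⟫ := by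
    have hn : Integrable (fun ω => -⟪X ω - f (τ ω), f (τ ω)⟫) P :=
      (integrable_inner_residual hX2 hτ.measurable f.continuous.measurable f.norm_coe_le_norm).neg
    rw [← integral_inner_kinkCurve hX2 hτ.measurable, ← integral_neg, ← integral_add hn
      (integrable_inner_residual hX2 hτ.measurable (ContinuousMap.continuous _).measurable
        (ContinuousMap.norm_coe_le_norm _))]
    simp only [ContinuousMap.add_apply, ContinuousMap.neg_apply, inner_add_right, inner_neg_right]
  rw [hsplit, h a, hv, real_inner_smul_left, real_inner_smul_right, ← hq,
    real_inner_self_eq_norm_sq] at key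
  have : 0 < lam * (L / (2 * ‖q‖) * ‖q‖ ^ 2) := by positivity
  linarith

/-- Either `ν` charges three disjoint sets, or the curve lies on a line. -/
theorem three_charged_sets_or_line {ν : VecSignedMeasure d} (hL : 0 < L)
    (hκ : κ = CurveKind.closedCurves → f 0 = f 1) (hν : IsSecondDerivative κ f ν)
    (hdiff : ∀ t : I, t < 1 → RightDifferentiableAt f t) (h0 : ‖rightDeriv f 0‖ = L)
    (h1 : ‖leftDeriv f 1‖ = L) :
    (∃ A B C : Set I, MeasurableSet A ∧ MeasurableSet B ∧ MeasurableSet C ∧ Disjoint A B ∧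
      Disjoint A C ∧ Disjoint B C ∧ ν.value A ≠ 0 ∧ ν.value B ≠ 0 ∧ ν.value C ≠ 0) ∨
    ∃ (x : I → ℝ) (u : E d), Continuous x ∧ ∀ t, f t = f 0 + x t • u := by
  by_cases hthree : ∃ A B C : Set I, MeasurableSet A ∧ MeasurableSet B ∧ MeasurableSet C ∧
      Disjoint A B ∧ Disjoint A C ∧ Disjoint B C ∧ ν.value A ≠ 0 ∧ ν.value B ≠ 0 ∧ ν.value C ≠ 0
  · exact Or.inl hthree
  refine Or.inr ?_
  cases hk : κ with
  | openCurves =>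
    refine exists_line_of_two_values hdiff (v := rightDeriv f 0) (w := rightDeriv f 0)
      (fun t ht => ?_) (Or.inr rfl)
    -- Both endpoint atoms have norm `L > 0`, so any change of the right derivative provides a third
    -- charged set.
    by_contra hne
    refine hthree ⟨{0}, {1}, Ioc 0 t, measurableSet_singleton _, measurableSet_singleton _,
      measurableSet_Ioc, by simp, by simp, by simp [ht], ?_, ?_, ?_⟩
    · rw [hν.atom_zero hk, ← norm_ne_zero_iff, h0]; exact hL.ne'
    · rw [hν.atom_one hk, neg_ne_zero, ← norm_ne_zero_iff, h1]; exact hL.ne'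
    · rw [hν.increment 0 t unitInterval.nonneg' ht, sub_ne_zero]
      tauto
  | closedCurves =>
    -- Three parameters cut the circle into three arcs, and pairwise distinct derivatives would make
    -- all of them charged. Hence at most two values occur.
    have hordered : ∀ r s t : I, r < s → s < t → t < 1 → rightDeriv f r ≠ rightDeriv f s →
        rightDeriv f s ≠ rightDeriv f t → rightDeriv f r = rightDeriv f t := by
      intro r s t hrs hst ht h1 h2
      by_contra h3
      have hd : ∀ a b : I, r ≤ a → b ≤ t → Disjoint (Ioc a b) (Ioc r t)ᶜ := fun a b ha hb =>
        disjoint_compl_right_iff_subset.2 (Ioc_subset_Ioc ha hb)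
      refine hthree ⟨Ioc r s, Ioc s t, (Ioc r t)ᶜ, measurableSet_Ioc, measurableSet_Ioc,
        measurableSet_Ioc.compl, ?_, hd _ _ le_rfl hst.le, hd _ _ hrs.le le_rfl, ?_, ?_, ?_⟩
      · exact disjoint_left.2 fun x hx hx' => not_lt_of_ge hx.2 hx'.1
      · rw [hν.increment r s hrs.le (hst.trans ht)]
        exact sub_ne_zero.2 h1.symm
      · rw [hν.increment s t hst.le ht]
        exact sub_ne_zero.2 h2.symm
      · rw [value_compl measurableSet_Ioc, hν.total, hν.increment r t (hrs.trans hst).le ht, zero_sub,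
          neg_ne_zero]
        exact sub_ne_zero.2 (Ne.symm h3)
    by_cases hall : ∀ t : I, t < 1 → rightDeriv f t = rightDeriv f 0
    · exact exists_line_of_two_values hdiff (fun t ht => Or.inl (hall t ht)) (Or.inr rfl)
    push Not at hall
    obtain ⟨s, hs, hs0⟩ := hall
    refine exists_line_of_two_values hdiff (v := rightDeriv f 0) (w := rightDeriv f s)
      (fun t ht => ?_) (Or.inl (hκ hk))
    by_contra! hcon
    have hpos : ∀ t : I, rightDeriv f t ≠ rightDeriv f 0 → 0 < t := fun t ht =>
      lt_of_le_of_ne unitInterval.nonneg' fun h => ht (by rw [h])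
    rcases lt_trichotomy s t with h | rfl | h
    · exact hcon.1 (hordered 0 s t (hpos s hs0) h ht hs0.symm hcon.2.symm).symm
    · exact hcon.2 rfl
    · exact hs0 (hordered 0 t s (hpos t hcon.1) h hs hcon.1.symm hcon.2).symm

/-- Switching between two choices of nearest parameters on an event where both avoid a charged set
does not change the residual measure. -/
theorem setIntegral_switch_eq_zero (hX2 : MemLp X 2 P) (hτ : IsNearest P X f τ)
    (hτ' : IsNearest P X f τ')
    (hτ1 : κ = CurveKind.closedCurves → ∀ ω, τ ω ≠ 1)
    (hτ1' : κ = CurveKind.closedCurves → ∀ ω, τ' ω ≠ 1) (hf : IsOptimal P X κ L f) (hL : 0 < L)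
    (hlip : LipschitzWith L.toNNReal f) (hpos : 0 < criterion P X f) {ν : VecSignedMeasure d}
    (hν : IsSecondDerivative κ f ν) (hν1 : κ = CurveKind.closedCurves → ν.value {1} = 0)
    {lam' : ℝ} (hm' : ∀ A, MeasurableSet A → residualMass P X f τ' A = -lam' • ν.value A)
    {A K : Set I} (hA : MeasurableSet A) (hK : MeasurableSet K) (hK0 : ν.value K ≠ 0)
    {S : Set Ω} (hS : MeasurableSet S) (hSK : ∀ ω ∈ S, τ ω ∉ K ∧ τ' ω ∉ K) :
    ∫ ω in S, ((τ ⁻¹' A).indicator (fun ω => X ω - f (τ ω)) ω -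
      (τ' ⁻¹' A).indicator (fun ω => X ω - f (τ' ω)) ω) ∂P = 0 := by
  classical
  set D : Ω → E d := fun ω => (τ ⁻¹' A).indicator (fun ω => X ω - f (τ ω)) ω -
    (τ' ⁻¹' A).indicator (fun ω => X ω - f (τ' ω)) ω with hD
  have hAτ := hτ.measurable hA
  have hAτ' := hτ'.measurable hA
  have hi := (integrable_residual (f := f) hX2 hτ.measurable).indicator hAτ
  have hi' := (integrable_residual (f := f) hX2 hτ'.measurable).indicator hAτ'
  have hDint : Integrable D P := hi.sub hi'
  set ρ : Ω → I := fun ω => if ω ∈ S then τ ω else τ' ω with hρ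
  have hρn : IsNearest P X f ρ := by
    refine ⟨Measurable.ite hS hτ.measurable hτ'.measurable, ?_⟩
    filter_upwards [hτ.nearest, hτ'.nearest] with ω h1 h2
    by_cases h : ω ∈ S
    · simpa only [hρ, if_pos h] using h1
    · simpa only [hρ, if_neg h] using h2
  obtain ⟨c', hc', hmρ⟩ := exists_residualMass_eq hX2 hρn (fun hk ω => by
    by_cases h : ω ∈ S
    · simpa only [hρ, if_pos h] using hτ1 hk ω
    · simpa only [hρ, if_neg h] using hτ1' hk ω) hf hL hlip hpos hν hν1
  -- Neither choice visits `K` on `S`, so the mixture leaves the mass of `K` unchanged. As `K` is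
  -- charged, this pins the multiplier of `ρ` to `lam'`, and hence its mass on `A` as well.
  have hKeq : residualMass P X f ρ K = residualMass P X f τ' K := by
    have hind : ∀ ω, (ρ ⁻¹' K).indicator (fun ω => X ω - f (ρ ω)) ω =
        (τ' ⁻¹' K).indicator (fun ω => X ω - f (τ' ω)) ω := by
      intro ω
      by_cases h : ω ∈ S
      · have h1 := hSK ω h
        rw [indicator_of_notMem, indicator_of_notMem (show ω ∉ τ' ⁻¹' K from h1.2)]
        simpa only [hρ, mem_preimage, if_pos h] using h1.1
      · simp only [indicator, hρ, mem_preimage, if_neg h]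
    rw [residualMass, residualMass, ← integral_indicator (hρn.measurable hK),
      ← integral_indicator (hτ'.measurable hK)]
    exact integral_congr_ae (Filter.Eventually.of_forall hind)
  have hcc : c' = lam' := by
    rw [hmρ K hK, hm' K hK] at hKeq
    exact neg_injective (smul_left_injective ℝ hK0 hKeq)
  have hAeq : residualMass P X f ρ A = residualMass P X f τ' A := by
    rw [hmρ A hA, hm' A hA, hcc]
  have hsum : residualMass P X f ρ A = residualMass P X f τ' A + ∫ ω in S, D ω ∂P := by
    rw [residualMass, residualMass, ← integral_indicator (hρn.measurable hA),
      ← integral_indicator hAτ', ← integral_indicator hS,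
      ← integral_add hi' (hDint.indicator hS)]
    refine integral_congr_ae (Filter.Eventually.of_forall fun ω => ?_)
    by_cases h : ω ∈ S
    · simp [indicator, hρ, hD, h]
    · simp [indicator, hρ, h]
  rw [hAeq] at hsum
  exact left_eq_add.1 hsum

/-- Two choices of nearest parameters on the same probability space have the same multiplier. -/
theorem multiplier_unique (hX2 : MemLp X 2 P) (hτ : IsNearest P X f τ) (hτ' : IsNearest P X f τ')
    (hτ1 : κ = CurveKind.closedCurves → ∀ ω, τ ω ≠ 1)
    (hτ1' : κ = CurveKind.closedCurves → ∀ ω, τ' ω ≠ 1) (hf : IsOptimal P X κ L f) (hL : 0 < L)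
    (hlip : LipschitzWith L.toNNReal f) (hpos : 0 < criterion P X f) {ν : VecSignedMeasure d}
    (hν : IsSecondDerivative κ f ν) (hν1 : κ = CurveKind.closedCurves → ν.value {1} = 0)
    {lam lam' : ℝ} (hm : ∀ A, MeasurableSet A → residualMass P X f τ A = -lam • ν.value A)
    (hm' : ∀ A, MeasurableSet A → residualMass P X f τ' A = -lam' • ν.value A) : lam = lam' := by
  obtain ⟨c, hc, hck⟩ := exists_pos_multiplier hX2 hτ hτ1 hf hL hlip hpos
  have hlen := length_eq_of_isOptimal hX2 hτ hτ1 hf hpos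
  have hdiff : ∀ t : I, t < 1 → RightDifferentiableAt f t := fun t ht =>
    (hasDerivWithinAt_extend_right hX2 hτ.measurable hc hck ht).differentiableWithinAt
  rcases three_charged_sets_or_line hL hf.mem.2 hν hdiff
    (norm_rightDeriv_eq hX2 hτ.measurable hL hlip hlen hc hck zero_lt_one)
    (norm_leftDeriv_eq hX2 hτ.measurable hL hlip hlen hc hck zero_lt_one) with
    ⟨A, B, C, hA, hB, hC, hAB, hAC, hBC, hA0, hB0, hC0⟩ | ⟨x, u, hx, hfx⟩
  · set D : Ω → E d := fun ω => (τ ⁻¹' A).indicator (fun ω => X ω - f (τ ω)) ω -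
      (τ' ⁻¹' A).indicator (fun ω => X ω - f (τ' ω)) ω with hD
    have hAτ := hτ.measurable hA
    have hAτ' := hτ'.measurable hA
    have hi := (integrable_residual (f := f) hX2 hτ.measurable).indicator hAτ
    have hi' := (integrable_residual (f := f) hX2 hτ'.measurable).indicator hAτ'
    have hDint : Integrable D P := hi.sub hi'
    have hswitch : ∀ (S : Set Ω) (K : Set I), MeasurableSet S → MeasurableSet K → ν.value K ≠ 0 →
        (∀ ω ∈ S, τ ω ∉ K ∧ τ' ω ∉ K) → ∫ ω in S, D ω ∂P = 0 := fun S K hS hK hK0 hSK =>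
      setIntegral_switch_eq_zero hX2 hτ hτ' hτ1 hτ1' hf hL hlip hpos hν hν1 hm' hA hK hK0 hS hSK
    -- The three events partition `Ω` and use `A`, `B`, `C` in turn as the avoided set. On the last
    -- one, one choice lies in `A` and the other in `B`, so neither lies in `C`.
    set S₁ : Set Ω := τ ⁻¹' Aᶜ ∩ τ' ⁻¹' Aᶜ with hS₁
    set S₂ : Set Ω := S₁ᶜ ∩ (τ ⁻¹' Bᶜ ∩ τ' ⁻¹' Bᶜ) with hS₂
    set S₃ : Set Ω := S₁ᶜ \ (τ ⁻¹' Bᶜ ∩ τ' ⁻¹' Bᶜ) with hS₃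
    have hS₁m : MeasurableSet S₁ := (hτ.measurable hA.compl).inter (hτ'.measurable hA.compl)
    have hTm : MeasurableSet (τ ⁻¹' Bᶜ ∩ τ' ⁻¹' Bᶜ) :=
      (hτ.measurable hB.compl).inter (hτ'.measurable hB.compl)
    have h1 := hswitch S₁ A hS₁m hA hA0 fun ω hω => hω
    have h2 := hswitch S₂ B (hS₁m.compl.inter hTm) hB hB0 fun ω hω => hω.2
    have h3 := hswitch S₃ C (hS₁m.compl.diff hTm) hC hC0 fun ω hω => by
      have hA' : τ ω ∈ A ∨ τ' ω ∈ A := by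
        by_contra! hcon
        exact hω.1 hcon
      have hB' : τ ω ∈ B ∨ τ' ω ∈ B := by
        by_contra! hcon
        exact hω.2 hcon
      rcases hA' with h | h
      · exact ⟨disjoint_left.1 hAC h,
          disjoint_left.1 hBC (hB'.resolve_left (disjoint_left.1 hAB h))⟩
      · exact ⟨disjoint_left.1 hBC (hB'.resolve_right (disjoint_left.1 hAB h)),
          disjoint_left.1 hAC h⟩
    have htotal : ∫ ω, D ω ∂P = 0 := by
      have e1 := integral_inter_add_sdiff (s := S₁ᶜ) hTm hDint.integrableOn
      rw [h2, h3, add_zero] at e1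
      rw [← integral_add_compl hS₁m hDint, h1, ← e1, add_zero]
    have hfinal : residualMass P X f τ A = residualMass P X f τ' A := by
      rw [residualMass, residualMass, ← integral_indicator hAτ, ← integral_indicator hAτ',
        ← sub_eq_zero, ← integral_sub hi hi']
      exact htotal
    rw [hm A hA, hm' A hA] at hfinal
    exact neg_injective (smul_left_injective ℝ hA0 hfinal)
  · have hae : ∀ᵐ ω ∂P, f (τ ω) = f (τ' ω) := by
      filter_upwards [hτ.nearest, hτ'.nearest] with ω h1 h2
      exact eq_of_nearest_of_line hx hfx h1 h2
    -- On a line the nearest points coincide almost surely. Testing both relations with `g = f` then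
    -- separates the multipliers, since the common expectation is nonzero.
    have hrel : ∀ (ρ : Ω → I) (r : ℝ), Measurable ρ →
        (∀ A, MeasurableSet A → residualMass P X f ρ A = -r • ν.value A) →
        ∫ ω, ⟪X ω - f (ρ ω), f (ρ ω)⟫ ∂P = -r * ν.integral f := by
      intro ρ r hρ h
      have h1 : ∀ j, residualMeasure P X f ρ 1 j = (-r) • ν j := by
        intro j
        refine VectorMeasure.ext fun A hA => ?_
        have h2 := value_residualMeasure (f := f) hX2 hρ 1 hA
        rw [one_smul, h A hA] at h2
        exact congrArg (fun v : E d => v j) h2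
      have h3 := integral_residualMeasure (f := f) hX2 hρ 1 f.continuous.measurable
        f.norm_coe_le_norm
      rw [one_mul] at h3
      rw [← h3, VecSignedMeasure.integral, VecSignedMeasure.integral, Finset.mul_sum]
      refine Finset.sum_congr rfl fun j _ => ?_
      rw [h1 j, VectorMeasure.integral_smul_vectorMeasure, smul_eq_mul]
    have hp := integral_inner_self_pos hX2 hτ hf hL hlen hc hck
    have e1 := hrel τ lam hτ.measurable hm
    have e2 := hrel τ' lam' hτ'.measurable hm'
    have e3 : ∫ ω, ⟪X ω - f (τ ω), f (τ ω)⟫ ∂P = ∫ ω, ⟪X ω - f (τ' ω), f (τ' ω)⟫ ∂P := by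
      refine integral_congr_ae ?_
      filter_upwards [hae] with ω hω
      rw [hω]
    rw [e1] at hp
    rw [e1, e2] at e3
    have hne : ν.integral f ≠ 0 := by
      intro h
      rw [h, mul_zero] at hp
      exact lt_irrefl _ hp
    exact neg_injective (mul_right_cancel₀ hne e3)

end PrincipalCurve

/-! ### Measurable selection, extensions and gluing of the endpoints -/

namespace PrincipalCurve

section Selection

variable {d : ℕ} (f : C(I, E d)) {x : E d}

theorem norm_sub_eq_iInf_iff {t : I} :
    ‖x - f t‖ = ⨅ r : I, ‖x - f r‖ ↔ ∀ r : I, ‖x - f t‖ ≤ ‖x - f r‖ :=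
  ⟨fun h r => h ▸ ciInf_le (bddBelow_norm_sub x f) r,
    fun h => le_antisymm (le_ciInf h) (ciInf_le (bddBelow_norm_sub x f) t)⟩

/-- The smallest parameter of a point of the curve closest to `x`. -/
noncomputable def firstNearest (x : E d) : I :=
  sInf {t : I | ∀ r : I, ‖x - f t‖ ≤ ‖x - f r‖}

theorem firstNearest_mem (x : E d) : ∀ r : I, ‖x - f (firstNearest f x)‖ ≤ ‖x - f r‖ := by
  have hclosed : IsClosed {t : I | ∀ r : I, ‖x - f t‖ ≤ ‖x - f r‖} := by
    simp only [ofPred_forall]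
    exact isClosed_iInter fun r => isClosed_le (by fun_prop) continuous_const
  obtain ⟨t, -, ht⟩ := isCompact_univ.exists_isMinOn (univ_nonempty (α := I))
    (f := fun t : I => ‖x - f t‖) (by fun_prop)
  exact hclosed.isCompact.sInf_mem ⟨t, fun r => ht (mem_univ r)⟩

/-- The sublevel sets are projections along the compact interval of closed sets, hence closed. -/
theorem measurable_firstNearest : Measurable (firstNearest f) := by
  refine measurable_of_Iic fun s => IsClosed.measurableSet ?_
  have hclosed : IsClosed {p : E d × I | p.2 ≤ s ∧ ∀ r : I, ‖p.1 - f p.2‖ ≤ ‖p.1 - f r‖} := by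
    rw [ofPred_and]
    refine (isClosed_le (by fun_prop) continuous_const).inter ?_
    simp only [ofPred_forall]
    exact isClosed_iInter fun r => isClosed_le (by fun_prop) (by fun_prop)
  convert isClosedMap_fst_of_compactSpace _ hclosed using 1
  ext x
  constructor
  · exact fun h => ⟨(x, firstNearest f x), ⟨h, firstNearest_mem f x⟩, rfl⟩
  · rintro ⟨⟨y, t⟩, ⟨h1, h2⟩, rfl⟩
    exact (sInf_le (s := {t : I | ∀ r : I, ‖y - f t‖ ≤ ‖y - f r‖}) h2).trans h1

/-- If `1` is nearest then so is `0`, which is smaller. This supplies the normalization for closed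
curves. -/
theorem firstNearest_ne_one (h : f 0 = f 1) (x : E d) : firstNearest f x ≠ 1 := by
  intro hx
  have h0 : firstNearest f x ≤ 0 := sInf_le fun r => by
    have := firstNearest_mem f x r
    rwa [hx, ← h] at this
  rw [hx] at h0
  exact absurd h0 (not_le.2 zero_lt_one)

end Selection

variable {Ω : Type*} [MeasurableSpace Ω] {P : Measure Ω} {d : ℕ}
  {X : Ω → E d} {f : C(I, E d)} {τ : Ω → I} {κ : CurveKind} {L : ℝ}

theorem isNearest_firstNearest (hX : Measurable X) (f : C(I, E d)) :
    IsNearest P X f fun ω => firstNearest f (X ω) where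
  measurable := (measurable_firstNearest f).comp hX
  nearest := Filter.Eventually.of_forall fun ω =>
    (norm_sub_eq_iInf_iff f).2 (firstNearest_mem f (X ω))

theorem isOptimal_of_criterion_eq (hf : f ∈ curveClass κ d L)
    (hfmin : criterion P X f = optimalValue P X κ L) : IsOptimal P X κ L f where
  mem := hf
  le h hh := by
    rw [hfmin]
    refine csInf_le ⟨0, ?_⟩ (mem_image_of_mem _ hh)
    rintro _ ⟨k, -, rfl⟩
    exact integral_nonneg fun ω => Real.iInf_nonneg fun t => by positivity

section Extension

variable {Ω' : Type*} [MeasurableSpace Ω'] {P' : Measure Ω'} {p : Ω' → Ω}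

/-- The squared distance to the curve is a measurable function of `X` alone, by way of the first
nearest parameter, so optimality passes to extensions. -/
theorem criterion_comp (hp : MeasurePreserving p P' P) (hX : Measurable X) (h : C(I, E d)) :
    criterion P' (X ∘ p) h = criterion P X h := by
  have hτ := isNearest_firstNearest (P := P) hX h
  rw [criterion_eq (isNearest_firstNearest (P := P') (hX.comp hp.measurable) h), criterion_eq hτ,
    ← hp.map_eq, integral_map hp.measurable.aemeasurable]
  · rfl
  · exact ((hX.sub (h.continuous.measurable.comp hτ.measurable)).norm.pow_const
      2).aestronglyMeasurable

theorem IsOptimal.comp (hf : IsOptimal P X κ L f) (hp : MeasurePreserving p P' P)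
    (hX : Measurable X) : IsOptimal P' (X ∘ p) κ L f where
  mem := hf.mem
  le h hh := by
    rw [criterion_comp hp hX, criterion_comp hp hX]
    exact hf.le h hh

theorem residualMass_comp (hp : MeasurePreserving p P' P) (hX : Measurable X) (hτ : Measurable τ)
    {A : Set I} (hA : MeasurableSet A) :
    residualMass P' (X ∘ p) f (τ ∘ p) A = residualMass P X f τ A := by
  rw [residualMass, residualMass, ← hp.map_eq, setIntegral_map (hτ hA) _ hp.measurable.aemeasurable]
  · rfl
  · exact (hX.sub (f.continuous.measurable.comp hτ)).aestronglyMeasurable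

end Extension

/-- The parameter `1` moved to `0`, the other parameter of the same point of a closed curve. -/
noncomputable def glue (t : I) : I := open Classical in if t = 1 then 0 else t

theorem measurable_glue : Measurable glue := by
  classical
  exact Measurable.ite (measurableSet_singleton _) measurable_const measurable_id

theorem glue_ne_one (t : I) : glue t ≠ 1 := by
  rw [glue]
  split_ifs with h
  · exact zero_ne_one
  · exact h

theorem glue_of_ne {t : I} (h : t ≠ 1) : glue t = t := if_neg h

theorem apply_glue (h : f 0 = f 1) (t : I) : f (glue t) = f t := by
  rw [glue]
  split_ifs with h1
  · rw [h1, h]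
  · rfl

theorem residualMass_glue (h : f 0 = f 1) (A : Set I) :
    residualMass P X f (glue ∘ τ) A = residualMass P X f τ (glue ⁻¹' A) := by
  simp only [residualMass, Function.comp_apply, apply_glue h, preimage_comp]

theorem IsNearest.glue_comp (hτ : IsNearest P X f τ) (h : f 0 = f 1) :
    IsNearest P X f (glue ∘ τ) where
  measurable := measurable_glue.comp hτ.measurable
  nearest := by simpa only [Function.comp_apply, apply_glue h] using hτ.nearest

variable [IsProbabilityMeasure P]

theorem integral_inner_indicator (hX2 : MemLp X 2 P) (hτ : Measurable τ) {A : Set I}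
    (hA : MeasurableSet A) (v : E d) :
    ∫ ω, ⟪X ω - f (τ ω), A.indicator (fun _ => v) (τ ω)⟫ ∂P = ⟪residualMass P X f τ A, v⟫ := by
  rw [residualMass, real_inner_comm, ← integral_inner (integrable_residual hX2 f hτ).integrableOn,
    ← integral_indicator (hτ hA)]
  refine integral_congr_ae (Filter.Eventually.of_forall fun ω => ?_)
  by_cases h : τ ω ∈ A
  · simp [indicator, h, real_inner_comm]
  · simp [indicator, h]

/-- The residual measure is determined by its integrals against bounded Borel functions. -/
theorem residualMass_eq_of_integral (hX2 : MemLp X 2 P) (hτ : Measurable τ)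
    {Ω' : Type*} [MeasurableSpace Ω'] {P' : Measure Ω'} [IsProbabilityMeasure P'] {X' : Ω' → E d}
    (hX2' : MemLp X' 2 P') {τ' : Ω' → I} (hτ' : Measurable τ') {a c : ℝ}
    (h : ∀ g : I → E d, Measurable g → (∃ C : ℝ, ∀ t, ‖g t‖ ≤ C) →
      ∫ ω, ⟪X' ω - f (τ' ω), g (τ' ω)⟫ ∂P' = a * (residualMeasure P X f τ c).integral g)
    {A : Set I} (hA : MeasurableSet A) :
    residualMass P' X' f τ' A = a • (residualMeasure P X f τ c).value A := by
  refine ext_inner_right ℝ fun v => ?_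
  have hg : Measurable (A.indicator fun _ => v) := measurable_const.indicator hA
  have hC : ∀ t, ‖A.indicator (fun _ => v) t‖ ≤ ‖v‖ := fun t => norm_indicator_le_norm_self _ t
  rw [← integral_inner_indicator hX2' hτ' hA, h _ hg ⟨_, hC⟩, integral_residualMeasure hX2 hτ c hg hC,
    integral_inner_indicator hX2 hτ hA, value_residualMeasure hX2 hτ c hA, real_inner_smul_left,
    real_inner_smul_left]

/-- The multiplier does not depend on the extension of the probability space. -/
theorem HasProjectionIndex.eq_multiplier {Ω : Type u} [MeasurableSpace Ω] {P : Measure Ω}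
    [IsProbabilityMeasure P] {X : Ω → E d} {τ : Ω → I} (hX : Measurable X) (hX2 : MemLp X 2 P)
    (hτ : IsNearest P X f τ) (hτ1 : κ = CurveKind.closedCurves → ∀ ω, τ ω ≠ 1)
    (hf : IsOptimal P X κ L f) (hL : 0 < L) (hlip : LipschitzWith L.toNNReal f)
    (hpos : 0 < criterion P X f) {lam : ℝ} (hlam : 0 < lam)
    (hν : IsSecondDerivative κ f (residualMeasure P X f τ (-lam⁻¹))) {lam' : ℝ}
    (h : HasProjectionIndex P X f (residualMeasure P X f τ (-lam⁻¹)) lam') : lam' = lam := by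
  obtain ⟨Ω', _, P', p, τ', _, hp, hτ'm, hτ'n, hint⟩ := h
  have hX2' : MemLp (X ∘ p) 2 P' := hX2.comp_measurePreserving hp
  set ν := residualMeasure P X f τ (-lam⁻¹) with hνdef
  have hval : ∀ A, MeasurableSet A → residualMass P X f τ A = -lam • ν.value A := fun A hA => by
    rw [value_residualMeasure hX2 hτ.measurable _ hA, smul_smul, neg_mul_neg,
      mul_inv_cancel₀ hlam.ne', one_smul]
  have hτ' : IsNearest P' (X ∘ p) f τ' := ⟨hτ'm, hτ'n⟩
  have hm' : ∀ A, MeasurableSet A → residualMass P' (X ∘ p) f τ' A = -lam' • ν.value A :=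
    fun A hA => residualMass_eq_of_integral hX2 hτ.measurable hX2' hτ'm hint hA
  -- Lifting `τ` to the extension puts both choices on one space, where they can be mixed.
  have hτp : IsNearest P' (X ∘ p) f (τ ∘ p) :=
    ⟨hτ.measurable.comp hp.measurable, hp.quasiMeasurePreserving.ae hτ.nearest⟩
  have hmp : ∀ A, MeasurableSet A → residualMass P' (X ∘ p) f (τ ∘ p) A = -lam • ν.value A :=
    fun A hA => (residualMass_comp hp hX hτ.measurable hA).trans (hval A hA)
  have hν1 : κ = CurveKind.closedCurves → ν.value {1} = 0 := fun hκ => by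
    rw [value_residualMeasure hX2 hτ.measurable _ (measurableSet_singleton _),
      residualMass_one_eq_zero (hτ1 hκ), smul_zero]
  -- In the closed case `τ'` may take the value `1` and is glued to avoid it. The relation to `ν`
  -- persists because `ν` comes from a `τ` that never equals `1`, and so gives `A` and `glue ⁻¹' A`
  -- the same mass.
  obtain ⟨ρ, hρ, hρ1, hmρ⟩ : ∃ ρ : Ω' → I, IsNearest P' (X ∘ p) f ρ ∧
      (κ = CurveKind.closedCurves → ∀ ω, ρ ω ≠ 1) ∧
      ∀ A, MeasurableSet A → residualMass P' (X ∘ p) f ρ A = -lam' • ν.value A := by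
    by_cases hκ : κ = CurveKind.closedCurves
    · have hcl := hf.mem.2 hκ
      refine ⟨glue ∘ τ', hτ'.glue_comp hcl, fun _ ω => glue_ne_one _, fun A hA => ?_⟩
      have hg : τ ⁻¹' (glue ⁻¹' A) = τ ⁻¹' A := by
        ext ω
        simp only [mem_preimage, glue_of_ne (hτ1 hκ ω)]
      rw [residualMass_glue hcl, hm' _ (measurable_glue hA), hνdef,
        value_residualMeasure hX2 hτ.measurable _ (measurable_glue hA),
        value_residualMeasure hX2 hτ.measurable _ hA, residualMass, residualMass, hg]
    · exact ⟨τ', hτ', fun h => absurd h hκ, hm'⟩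
  refine (multiplier_unique hX2' hτp hρ (fun hκ ω => hτ1 hκ (p ω)) hρ1 (hf.comp hp hX) hL hlip ?_ hν
    hν1 hmp hmρ).symm
  rwa [criterion_comp hp hX]

end PrincipalCurve

/-! ### The main theorem -/

theorem theorem1 {Ω : Type*} [MeasurableSpace Ω] (P : Measure Ω) [IsProbabilityMeasure P]
    (d : ℕ) (X : Ω → PrincipalCurve.E d) (hX : Measurable X) (hX2 : MemLp X 2 P)
    (κ : PrincipalCurve.CurveKind) (L : ℝ) (hL : 0 < L)
    (hG : 0 < PrincipalCurve.optimalValue P X κ L)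
    (f : C(unitInterval, PrincipalCurve.E d)) (hf : f ∈ PrincipalCurve.curveClass κ d L)
    (hfmin : PrincipalCurve.criterion P X f = PrincipalCurve.optimalValue P X κ L) :
    PrincipalCurve.length f = ENNReal.ofReal L ∧
    (LipschitzWith L.toNNReal f →
      (∀ t : unitInterval, t < 1 →
        PrincipalCurve.RightDifferentiableAt f t ∧ ‖PrincipalCurve.rightDeriv f t‖ = L) ∧
      (∀ t : unitInterval, 0 < t →
        PrincipalCurve.LeftDifferentiableAt f t ∧ ‖PrincipalCurve.leftDeriv f t‖ = L) ∧
      ∃ ν : PrincipalCurve.VecSignedMeasure d,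
        PrincipalCurve.IsSecondDerivative κ f ν ∧
        (∀ ν' : PrincipalCurve.VecSignedMeasure d, PrincipalCurve.IsSecondDerivative κ f ν' →
          PrincipalCurve.SameMeasure κ ν' ν) ∧
        (κ = PrincipalCurve.CurveKind.closedCurves →
          PrincipalCurve.VecSignedMeasure.value ν {1} = 0) ∧
        ∃! lam : ℝ, 0 < lam ∧ PrincipalCurve.HasProjectionIndex P X f ν lam) := by
  have hopt := PrincipalCurve.isOptimal_of_criterion_eq hf hfmin
  have hpos : 0 < PrincipalCurve.criterion P X f := hfmin ▸ hG
  have hτ := PrincipalCurve.isNearest_firstNearest (P := P) hX f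
  have hτ1 : κ = PrincipalCurve.CurveKind.closedCurves →
      ∀ ω, PrincipalCurve.firstNearest f (X ω) ≠ 1 :=
    fun hκ ω => PrincipalCurve.firstNearest_ne_one f (hf.2 hκ) (X ω)
  have hlen := PrincipalCurve.length_eq_of_isOptimal hX2 hτ hτ1 hopt hpos
  refine ⟨hlen, fun hlip => ?_⟩
  obtain ⟨lam, hlam, h⟩ := PrincipalCurve.exists_pos_multiplier hX2 hτ hτ1 hopt hL hlip hpos
  have hν := PrincipalCurve.isSecondDerivative_residualMeasure hX2 hτ.measurable
    (PrincipalCurve.integral_residual_eq_zero hX2 hτ hopt) hlam h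
  refine ⟨fun t ht => ⟨?_, ?_⟩, fun t ht => ⟨?_, ?_⟩, _, hν, fun ν' hν' => hν'.sameMeasure hν,
    fun hκ => ?_, lam, ⟨hlam, ?_⟩, fun lam' hlam' => ?_⟩
  · exact (PrincipalCurve.hasDerivWithinAt_extend_right hX2 hτ.measurable hlam h
      ht).differentiableWithinAt
  · exact PrincipalCurve.norm_rightDeriv_eq hX2 hτ.measurable hL hlip hlen hlam h ht
  · exact (PrincipalCurve.hasDerivWithinAt_extend_left hX2 hτ.measurable hlam h
      ht).differentiableWithinAt
  · exact PrincipalCurve.norm_leftDeriv_eq hX2 hτ.measurable hL hlip hlen hlam h ht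
  · rw [PrincipalCurve.value_residualMeasure hX2 hτ.measurable _ (measurableSet_singleton _),
      PrincipalCurve.residualMass_one_eq_zero (hτ1 hκ), smul_zero]
  -- Existence needs no genuine extension: the first nearest parameter on `Ω` itself works.
  · refine ⟨Ω, inferInstance, P, id, _, inferInstance, .id P, hτ.measurable, hτ.nearest,
      fun g hg ⟨C, hC⟩ => ?_⟩
    rw [PrincipalCurve.integral_residualMeasure hX2 hτ.measurable _ hg hC, ← mul_assoc, neg_mul_neg,
      mul_inv_cancel₀ hlam.ne', one_mul]
    rfl
  · exact hlam'.2.eq_multiplier hX hX2 hτ hτ1 hopt hL hlip hpos hlam hν
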